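/- Let $n$ be a positive integer and let $p,q\in\mathbb C$ with $|p|<1$, $q\neq0$. Put $(a;p)_\infty=\prod_{j\ge0}(1-ap^j)$, $\theta(a;p)=(a;p)_\infty(p/a;p)_\infty$ for $a\ne0$, and, for $k\in\mathbb Z$, $(a;q,p)_k=\prod_{j=0}^{k-1}\theta(aq^j;p)$ if $k\ge0$, $(a;q,p)_k=\prod_{j=k}^{-1}\theta(aq^j;p)^{-1}$ if $k<0$; write $(a_1,\dots,a_m;q,p)_k=\prod_i(a_i;q,p)_k$. For $k,j,N\in\mathbb Z_{\ge0}^n$ put $|k|=k_1+\dots+k_n$, and let $j\le N$ mean $j_r\le N_r$ for all $r$. Unless a range is shown, products over $r$ or $r,s$ run from $1$ to $n$. Fix nonzero $x_1,\dots,x_n\in\mathbb C$ and define $$B^{(1)}_{kj}(a,b)=\frac{(b/a;q,p)_{|k|-|j|}}{\prod_{r,s}(q^{1+j_r-j_s}x_r/x_s;q,p)_{k_r-j_r}}\prod_{r}\frac{(bx_r;q,p)_{j_r+|k|}}{(ax_rq;q,p)_{k_r+|j|}},$$ $$B^{(4)}_{kj}(a,b)=\frac{\prod_{r,s}(bx_rx_s;q,p)_{k_r+j_s}}{\prod_{r<s}(bx_rx_s;q,p)_{j_r+j_s}\prod_{r,s}(q^{1+j_r-j_s}x_r/x_s;q,p)_{k_r-j_r}}\prod_r\frac{(bx_r/a;q,p)_{k_r-|j|}}{(bx_r/a;q,p)_{j_r-|j|}\,(ax_rq;q,p)_{k_r+|j|}}.$$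 Sequences $\alpha_N(a,b),\beta_N(a,b)$, $N\in\mathbb Z_{\ge0}^n$, form a WP Bailey pair with respect to $\mathbf B$ at the parameters $(a,b)$ if $\beta_N(a,b)=\sum_{0\le j\le N}B_{Nj}(a,b)\,\alpha_j(a,b)$ for all $N$. **Theorem** (elliptic $\mathbf B^{(1)}\to\mathbf B^{(4)}$ WP Bailey lemma). Let $a,b,\rho_1,\rho_2$ be nonzero complex numbers such that no denominator in the formulas vanishes, that is, for all $1\le r,s\le n$ and all integers $m\ge0$: $\theta(q^{\ell}x_r/x_s;p)\ne0$ for all $\ell\in\mathbb Z$ with $r\neq s$ or $\ell\ne0$; $\theta(ax_rq^{m+1};p)\ne0$; $\theta(ax_rq^{m+1}/\rho_i;p)\neq0$ and $\theta(b\rho_ix_rq^m/a;p)\ne0$ for $i=1,2$; $\theta(b\rho_1\rho_2x_rq^{m}/aq;p)\neq0$; $\theta(bx_rx_sq^m;p)\ne0$ if $r<s$; and, if $n\ge2$, $\theta(bx_rq^{-m-1}/a;p)\ne0$. Suppose that $\alpha_N,\beta_N$ form a WP Bailey pair with respect to $\mathbf B^{(1)}$ at the parameters $(a,b\rho_1\rho_2/aq)$.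 Let $$\alpha'_N(a,b)=\frac{(\rho_1,\rho_2;q,p)_{|N|}}{\prod_r(ax_rq/\rho_1,ax_rq/\rho_2;q,p)_{N_r}}\Big(\frac{aq}{\rho_1\rho_2}\Big)^{|N|}\prod_rx_r^{N_r}\cdot q^{-\sum_{r<s}N_rN_s}\,\alpha_N(a,b\rho_1\rho_2/aq),$$ $$\begin{aligned}\beta'_N(a,b)={}&\prod_r\frac{(b\rho_1x_r/a,b\rho_2x_r/a;q,p)_{N_r}}{(ax_rq/\rho_1,ax_rq/\rho_2;q,p)_{N_r}}\sum_{0\le k\le N}\Bigg(\frac{(\rho_1,\rho_2;q,p)_{|k|}}{\prod_r(b\rho_1x_r/a,b\rho_2x_r/a;q,p)_{k_r}}\\&\times\prod_r\left(\frac{\theta(b\rho_1\rho_2x_rq^{k_r+|k|}/aq;p)}{\theta(b\rho_1\rho_2x_r/aq;p)}\,\frac{(ax_rq^{1+k_r-|k|}/\rho_1\rho_2;q,p)_{N_r-k_r}}{(b\rho_1\rho_2x_r/a;q,p)_{N_r+|k|}}\right)\\&\times\frac{\prod_{r,s}(bx_rx_s;q,p)_{N_s+k_r}}{\prod_{r<s}(bx_rx_s;q,p)_{k_r+k_s}\prod_{r,s}(q^{1+k_r-k_s}x_r/x_s;q,p)_{N_r-k_r}}\\&\times\Big(\frac{aq}{\rho_1\rho_2}\Big)^{|k|}\prod_rx_r^{k_r}\cdot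 q^{-\sum_{r<s}k_rk_s}\,\beta_k(a,b\rho_1\rho_2/aq)\Bigg).\end{aligned}$$ Then $\alpha'_N,\beta'_N$ form a WP Bailey pair with respect to $\mathbf B^{(4)}$ at the parameters $(a,b)$. (Here $/aq$ means $/(aq)$, and $/\rho_1\rho_2$ means $/(\rho_1\rho_2)$.) -/

import Mathlib

noncomputable section

namespace WPBailey

open Finset

/-- The infinite product `(a; p)_∞ = ∏_{j ≥ 0} (1 - a p^j)` (convergent for `|p| < 1`). -/
def infFac (p a : ℂ) : ℂ := ∏' j : ℕ, (1 - a * p ^ j)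

/-- The modified Jacobi theta function `θ(a; p) = (a; p)_∞ (p/a; p)_∞`, for `a ≠ 0`, `|p| < 1`. -/
def theta (p a : ℂ) : ℂ := infFac p a * infFac p (p / a)

/-- The `q, p`-shifted factorial `(a; q, p)_k` for an arbitrary integer `k`:
`∏_{j=0}^{k-1} θ(a q^j; p)` for `k ≥ 0`, and `(∏_{j=k}^{-1} θ(a q^j; p))⁻¹` for `k < 0`. -/
def ellFac (q p a : ℂ) : ℤ → ℂ
  | Int.ofNat k => ∏ j ∈ range k, theta p (a * q ^ j)
  | Int.negSucc m => (∏ j ∈ range (m + 1), theta p (a * q ^ (-((j : ℤ) + 1))))⁻¹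

/-- Multi-indices: `n`-tuples of non-negative integers. -/
abbrev MIdx (n : ℕ) := Fin n → ℕ

variable {n : ℕ}

/-- `|k| = k_1 + ⋯ + k_n`. -/
def size (k : MIdx n) : ℕ := ∑ r, k r

/-- `∑_{r < s} k_r k_s`. -/
def pairSum (k : MIdx n) : ℕ := ∑ r, ∑ s ∈ Ioi r, k r * k s

/-- The `A_n` elliptic Bressoud matrix `B⁽¹⁾_{k j}(a, b)`. -/
def B1 (q p : ℂ) (x : Fin n → ℂ) (a b : ℂ) (k j : MIdx n) : ℂ :=
  ellFac q p (b / a) ((size k : ℤ) - size j)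
      / (∏ r, ∏ s, ellFac q p (q ^ (1 + (j r : ℤ) - j s) * (x r / x s)) ((k r : ℤ) - j r))
    * ∏ r, (ellFac q p (b * x r) (j r + size k)
        / ellFac q p (a * x r * q) (k r + size j))

/-- The `D_n` elliptic Bressoud matrix `B⁽⁴⁾_{k j}(a, b)`. -/
def B4 (q p : ℂ) (x : Fin n → ℂ) (a b : ℂ) (k j : MIdx n) : ℂ :=
  (∏ r, ∏ s, ellFac q p (b * x r * x s) (k r + j s))
      / ((∏ r, ∏ s ∈ Ioi r, ellFac q p (b * x r * x s) (j r + j s))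
        * ∏ r, ∏ s, ellFac q p (q ^ (1 + (j r : ℤ) - j s) * (x r / x s)) ((k r : ℤ) - j r))
    * ∏ r, (ellFac q p (b * x r / a) ((k r : ℤ) - size j)
        / (ellFac q p (b * x r / a) ((j r : ℤ) - size j)
          * ellFac q p (a * x r * q) (k r + size j)))

/-- The sequences `α_N(a, b)` and `β_N(a, b)` form a WP Bailey pair, at the parameters `a, b`,
with respect to the matrix `B(a, b)`: for every `N`,
`β_N(a, b) = ∑_{0 ≤ j_r ≤ N_r} B_{N j}(a, b) α_j(a, b)`. -/
def IsWPBaileyPair (B : ℂ → ℂ → MIdx n → MIdx n → ℂ) (α β : ℂ → ℂ → MIdx n → ℂ)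
    (a b : ℂ) : Prop :=
  ∀ N : MIdx n, β a b N = ∑ j ∈ Iic N, B a b N j * α a b j

/-- The new sequence `α'_N(a, b)`. -/
def alphaPrime (q p : ℂ) (x : Fin n → ℂ) (ρ₁ ρ₂ : ℂ) (α : ℂ → ℂ → MIdx n → ℂ)
    (a b : ℂ) (N : MIdx n) : ℂ :=
  ellFac q p ρ₁ (size N) * ellFac q p ρ₂ (size N)
      / (∏ r, (ellFac q p (a * x r * q / ρ₁) (N r) * ellFac q p (a * x r * q / ρ₂) (N r)))
    * (a * q / (ρ₁ * ρ₂)) ^ size N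
    * (∏ r, x r ^ N r) * (q ^ pairSum N)⁻¹
    * α a (b * ρ₁ * ρ₂ / (a * q)) N

/-- The new sequence `β'_N(a, b)`. -/
def betaPrime (q p : ℂ) (x : Fin n → ℂ) (ρ₁ ρ₂ : ℂ) (β : ℂ → ℂ → MIdx n → ℂ)
    (a b : ℂ) (N : MIdx n) : ℂ :=
  (∏ r, (ellFac q p (b * ρ₁ * x r / a) (N r) * ellFac q p (b * ρ₂ * x r / a) (N r)
      / (ellFac q p (a * x r * q / ρ₁) (N r) * ellFac q p (a * x r * q / ρ₂) (N r))))
    * ∑ k ∈ Iic N,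
      (ellFac q p ρ₁ (size k) * ellFac q p ρ₂ (size k)
          / (∏ r, (ellFac q p (b * ρ₁ * x r / a) (k r) * ellFac q p (b * ρ₂ * x r / a) (k r)))
        * (∏ r, (theta p (b * ρ₁ * ρ₂ * x r * q ^ (k r + size k) / (a * q))
              / theta p (b * ρ₁ * ρ₂ * x r / (a * q))
            * (ellFac q p (a * x r * q ^ (1 + (k r : ℤ) - size k) / (ρ₁ * ρ₂)) ((N r : ℤ) - k r)
              / ellFac q p (b * ρ₁ * ρ₂ * x r / a) (N r + size k))))
        * ((∏ r, ∏ s, ellFac q p (b * x r * x s) (N s + k r))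
          / ((∏ r, ∏ s ∈ Ioi r, ellFac q p (b * x r * x s) (k r + k s))
            * ∏ r, ∏ s,
              ellFac q p (q ^ (1 + (k r : ℤ) - k s) * (x r / x s)) ((N r : ℤ) - k r)))
        * (a * q / (ρ₁ * ρ₂)) ^ size k
        * (∏ r, x r ^ k r) * (q ^ pairSum k)⁻¹
        * β a (b * ρ₁ * ρ₂ / (a * q)) k)

end WPBailey

end

/-! Inserting the Bailey pair relation for `β` into `β'_N` and exchanging the two summations reduces
the theorem to an identity for each fixed `j`: the sum over `k ≥ j` of the coefficients of `β'_N`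
times `B1` must equal `B4` times the factor in `α'_j`. After `k ↦ j + k` this inner sum is a `D_n`
elliptic Jackson sum in the variables `x_r q^{j_r}`, with `β = b ρ₁ ρ₂ q^{|j|} / (aq)` and
parameters `a q^{1+|j|}`, `b ρ₁ / a`, `b ρ₂ / a`. The matrix `B1` brings the first parameter and the
poles (`B1_add_left`), the coefficients of `β'_N` bring the rest (`betaPrefactor_mul_betaCoeff`),
and `B4_mul_alphaCoeff` identifies the value.

The Jackson summation `hasJacksonSum` is proved by induction on `|N|` through interpolation. Fix
`c₃` and `C = c₁ c₂`. Both sides, as functions of `c₁`, are combinations of products of `|N|`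
functions `θ(cu) θ(Cu/c)`. These functions span a space of dimension at most two
(`exists_theta_mul_theta_div`), so after division by a common factor both sides are polynomials of
degree at most `|N|` in one coordinate (`exists_affine_coordinate`). It therefore suffices to
compare them at `|N| + 1` points. At `c₁ = βq` only `k = 0` survives (`sum_jacksonTerm_beta`). At
`c₁ = (x_r q^m)⁻¹` with `m < N_r` the sum collapses to a Jackson sum with smaller limits
(`sum_jacksonTerm_node`). Coincidences between nodes are excluded for generic parameters and removed
by continuity.

The rank-two property comes from the Jacobi triple product: a product of two bilateral series splits
by the parity of the sum of the summation indices. -/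

noncomputable section

namespace WPBailey

open Finset

/-! ### The theta function: continuity, inversion and zeros. -/

section ThetaBasics

variable {p : ℂ}

theorem summable_norm_mul_pow (hp : ‖p‖ < 1) (a : ℂ) : Summable fun j : ℕ => ‖-(a * p ^ j)‖ := by
  simpa using (summable_geometric_of_lt_one (norm_nonneg p) hp).mul_left ‖a‖

theorem multipliable_infFac (hp : ‖p‖ < 1) (a : ℂ) :
    Multipliable fun j : ℕ => 1 - a * p ^ j := by
  simpa [sub_eq_add_neg] using multipliable_one_add_of_summable (summable_norm_mul_pow hp a)

theorem infFac_eq_mul (hp : ‖p‖ < 1) (a : ℂ) : infFac p a = (1 - a) * infFac p (a * p) := by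
  have e (j : ℕ) : 1 - a * p ^ (j + 1) = 1 - a * p * p ^ j := by ring
  have h : Multipliable fun j : ℕ => 1 - a * p ^ (j + 1) := by
    simpa only [e] using multipliable_infFac hp (a * p)
  have h2 := tprod_eq_zero_mul' (f := fun j : ℕ => 1 - a * p ^ j) h
  simp only [e, pow_zero, mul_one] at h2
  exact h2

theorem infFac_ne_zero (hp : ‖p‖ < 1) {a : ℂ} (h : ∀ j : ℕ, a * p ^ j ≠ 1) : infFac p a ≠ 0 := by
  have := tprod_one_add_ne_zero_of_summable (f := fun j : ℕ => -(a * p ^ j))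
    (fun j => by rw [← sub_eq_add_neg]; exact sub_ne_zero.2 (h j).symm)
    (summable_norm_mul_pow hp a)
  simpa [infFac, sub_eq_add_neg] using this

theorem continuous_infFac (hp : ‖p‖ < 1) : Continuous (infFac p) := by
  rw [continuous_iff_continuousAt]
  intro a
  have h := tendsto_tprod_one_add_of_dominated_convergence
    (𝓕 := nhds a) (f := fun (x : ℂ) (j : ℕ) => -(x * p ^ j)) (g := fun j : ℕ => -(a * p ^ j))
    (bound := fun j => (‖a‖ + 1) * ‖p‖ ^ j)
    ((summable_geometric_of_lt_one (norm_nonneg p) hp).mul_left _)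
    (fun k => by
      have : Continuous fun x : ℂ => -(x * p ^ k) := by fun_prop
      exact this.tendsto a)
    (by
      filter_upwards [(continuous_norm.tendsto a).eventually
        (gt_mem_nhds (lt_add_one ‖a‖))] with x hx k
      rw [norm_neg, norm_mul, norm_pow]
      gcongr)
  simp only [← sub_eq_add_neg] at h
  exact h

theorem continuousAt_theta (hp : ‖p‖ < 1) {a : ℂ} (ha : a ≠ 0) : ContinuousAt (theta p) a := by
  unfold theta
  exact ((continuous_infFac hp).continuousAt).mul
    (((continuous_infFac hp).continuousAt).comp (continuousAt_const.div continuousAt_id ha))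

theorem theta_one (hp : ‖p‖ < 1) : theta p 1 = 0 := by
  simp [theta, infFac_eq_mul hp 1]

theorem theta_inv (hp : ‖p‖ < 1) {a : ℂ} (ha : a ≠ 0) : theta p a⁻¹ = -(theta p a) / a := by
  unfold theta
  rw [infFac_eq_mul hp a, infFac_eq_mul hp a⁻¹, div_inv_eq_mul, mul_comm p a, inv_mul_eq_div]
  field_simp
  ring

/-- Countability is all that is needed later: a countable exceptional set can be avoided, and its
complement is dense. -/
theorem countable_theta_zeros (hp : ‖p‖ < 1) : {a : ℂ | theta p a = 0}.Countable := by
  have hsub : {a : ℂ | theta p a = 0} ⊆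
      (⋃ j : ℕ, {a | a * p ^ j = 1}) ∪ ⋃ j : ℕ, {a | p / a * p ^ j = 1} := by
    intro a h
    by_contra hc
    simp only [Set.mem_union, Set.mem_iUnion, Set.mem_ofPred_eq, not_or, not_exists] at hc
    exact mul_ne_zero (infFac_ne_zero hp hc.1) (infFac_ne_zero hp hc.2) h
  refine Set.Countable.mono hsub (.union (Set.countable_iUnion fun j => ?_)
    (Set.countable_iUnion fun j => ?_))
  · refine Set.Subsingleton.countable fun a ha b hb => ?_
    have hj : p ^ j ≠ 0 := right_ne_zero_of_mul (ha.trans_ne one_ne_zero)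
    exact mul_right_cancel₀ hj (ha.trans hb.symm)
  · refine Set.Subsingleton.countable fun a ha b hb => ?_
    have h (c : ℂ) (hc : p / c * p ^ j = 1) : c = p * p ^ j := by
      have : c ≠ 0 := by rintro rfl; simp at hc
      field_simp at hc
      rw [← hc]
    rw [h a ha, h b hb]

end ThetaBasics

/-! ### The `q`-binomial theorem and the finite triple product. -/

section TripleProduct

open Filter Topology

/-- The finite Euler product `(p; p)_n`. -/
def eulerFac (p : ℂ) (n : ℕ) : ℂ := ∏ j ∈ range n, (1 - p * p ^ j)

/-- The Gaussian binomial coefficient. -/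
def gaussBinom (p : ℂ) (N i : ℕ) : ℂ :=
  if i ≤ N then eulerFac p N / (eulerFac p i * eulerFac p (N - i)) else 0

variable {p : ℂ}

theorem mul_pow_ne_one_of_norm_lt_one (hp : ‖p‖ < 1) (j : ℕ) : p * p ^ j ≠ 1 := by
  intro h
  have h1 : ‖p‖ ^ (j + 1) = 1 := by rw [← norm_pow, pow_succ', h, norm_one]
  exact absurd h1 (pow_lt_one₀ (norm_nonneg p) hp (Nat.succ_ne_zero j)).ne

theorem eulerFac_ne_zero (hp : ‖p‖ < 1) (n : ℕ) : eulerFac p n ≠ 0 :=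
  prod_ne_zero_iff.2 fun j _ => sub_ne_zero.2 (mul_pow_ne_one_of_norm_lt_one hp j).symm

theorem eulerFac_succ (p : ℂ) (n : ℕ) : eulerFac p (n + 1) = eulerFac p n * (1 - p * p ^ n) :=
  prod_range_succ _ _

theorem gaussBinom_zero_right (hp : ‖p‖ < 1) (N : ℕ) : gaussBinom p N 0 = 1 := by
  have h0 : eulerFac p 0 = 1 := by simp [eulerFac]
  simp [gaussBinom, h0, div_self (eulerFac_ne_zero hp N)]

/-- The Pascal rule that drives the induction in the `q`-binomial theorem. For `i = N` the first
term on the right is the default value `0`. -/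
theorem gaussBinom_succ (hp : ‖p‖ < 1) {N i : ℕ} (h : i ≤ N) :
    gaussBinom p (N + 1) (i + 1)
      = gaussBinom p N (i + 1) + p ^ (N - i) * gaussBinom p N i := by
  have h0 : eulerFac p 0 = 1 := by simp [eulerFac]
  rcases h.eq_or_lt with rfl | h
  · simp [gaussBinom, h0, div_self (eulerFac_ne_zero hp _)]
  · obtain ⟨d, rfl⟩ := Nat.exists_eq_add_of_lt h
    have e1 : i + d + 1 + 1 - (i + 1) = d + 1 := by omega
    have e2 : i + d + 1 - (i + 1) = d := by omega
    have e3 : i + d + 1 - i = d + 1 := by omega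
    simp only [gaussBinom, e1, e2, e3, show i + 1 ≤ i + d + 1 + 1 by omega,
      show i + 1 ≤ i + d + 1 by omega, show i ≤ i + d + 1 by omega, if_true]
    rw [eulerFac_succ p (i + d + 1), eulerFac_succ p i, eulerFac_succ p d]
    have hi := eulerFac_ne_zero hp i
    have hd := eulerFac_ne_zero hp d
    have hi' := sub_ne_zero.2 (mul_pow_ne_one_of_norm_lt_one hp i).symm
    have hd' := sub_ne_zero.2 (mul_pow_ne_one_of_norm_lt_one hp d).symm
    field_simp
    ring

/-- The `q`-binomial theorem. -/
theorem prod_one_sub_mul_pow (hp : ‖p‖ < 1) (x : ℂ) (N : ℕ) :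
    ∏ j ∈ range N, (1 - x * p ^ j)
      = ∑ i ∈ range (N + 1), (-x) ^ i * p ^ (i.choose 2) * gaussBinom p N i := by
  induction N with
  | zero => simp [gaussBinom, eulerFac]
  | succ N ih =>
    rw [prod_range_succ, ih, sum_range_succ' _ (N + 1), mul_one_sub, sum_mul]
    have h1 : ∀ i ∈ range (N + 1),
        (-x) ^ (i + 1) * p ^ ((i + 1).choose 2) * gaussBinom p (N + 1) (i + 1)
          = (-x) ^ (i + 1) * p ^ ((i + 1).choose 2) * gaussBinom p N (i + 1)
            - (-x) ^ i * p ^ (i.choose 2) * gaussBinom p N i * (x * p ^ N) := by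
      intro i hi
      have hi : i ≤ N := Nat.lt_succ_iff.1 (mem_range.1 hi)
      rw [gaussBinom_succ hp hi, Nat.choose_succ_succ' i 1, Nat.choose_one_right]
      have : p ^ N = p ^ i * p ^ (N - i) := by rw [← pow_add, Nat.add_sub_cancel' hi]
      rw [this, pow_succ, pow_add]
      ring
    have h2 : gaussBinom p N (N + 1) = 0 := by simp [gaussBinom]
    let g : ℕ → ℂ := fun i => (-x) ^ i * p ^ (i.choose 2) * gaussBinom p N i
    have h3 : ∑ i ∈ range (N + 1), g (i + 1) + g 0 = ∑ i ∈ range (N + 1), g i + g (N + 1) :=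
      (sum_range_succ' g (N + 1)).symm.trans (sum_range_succ g (N + 1))
    simp only [g, h2, gaussBinom_zero_right hp, mul_zero, add_zero] at h3
    rw [sum_congr rfl h1, sum_sub_distrib, gaussBinom_zero_right hp, ← h3]
    ring

/-- The general term of the bilateral series `∑ P^{k(k-1)/2} X^k`. -/
def thetaTerm (P X : ℂ) (k : ℤ) : ℂ := P ^ (k * (k - 1) / 2) * X ^ k

/-- The integer division is exact, so identities between exponents can be checked after doubling. -/
theorem two_mul_triangle (k : ℤ) : 2 * (k * (k - 1) / 2) = k * (k - 1) :=
  Int.mul_ediv_cancel' (Int.even_mul_pred_self k).two_dvd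

theorem triangle_natCast (n : ℕ) : (n : ℤ) * (n - 1) / 2 = (n.choose 2 : ℕ) := by
  have h := two_mul_triangle n
  have h2 : ((n.choose 2 : ℕ) : ℤ) * 2 = n * (n - 1) := by
    rcases n with _ | n
    · simp
    · rw [Nat.choose_two_right]
      have h3 : (n + 1) * (n + 1 - 1) / 2 * 2 = (n + 1) * (n + 1 - 1) :=
        Nat.div_mul_cancel (Nat.even_mul_pred_self (n + 1)).two_dvd
      have h4 := congrArg (Nat.cast : ℕ → ℤ) h3
      push_cast at h4 ⊢
      simpa using h4
  omega

theorem summable_pow_choose_two_mul_pow {a r : ℝ} (ha0 : 0 < a) (ha : a < 1) (hr : 0 < r) :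
    Summable fun n : ℕ => a ^ n.choose 2 * r ^ n := by
  refine summable_of_ratio_test_tendsto_lt_one (l := 0) one_pos
    (Eventually.of_forall fun n => by positivity) ?_
  have h : Tendsto (fun n : ℕ => a ^ n * r) atTop (𝓝 (0 * r)) :=
    (tendsto_pow_atTop_nhds_zero_of_lt_one ha0.le ha).mul_const r
  rw [zero_mul] at h
  refine h.congr fun n => ?_
  rw [Real.norm_of_nonneg (by positivity), Real.norm_of_nonneg (by positivity),
    Nat.choose_succ_succ' n 1, Nat.choose_one_right, pow_add, pow_succ]
  field_simp

theorem summable_norm_thetaTerm {P X : ℂ} (hP0 : P ≠ 0) (hP : ‖P‖ < 1) (hX : X ≠ 0) :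
    Summable fun k => ‖thetaTerm P X k‖ := by
  have hP0' : 0 < ‖P‖ := norm_pos_iff.2 hP0
  have hX' : 0 < ‖X‖ := norm_pos_iff.2 hX
  refine Summable.of_nat_of_neg ?_ ?_
  · refine (summable_pow_choose_two_mul_pow hP0' hP hX').congr fun n => ?_
    simp [thetaTerm, triangle_natCast]
  -- At `-n` the exponent of `P` is `n.choose 2 + n`; the extra `P ^ n` turns the ratio into `‖P‖ /
  -- ‖X‖`.
  · refine (summable_pow_choose_two_mul_pow hP0' hP (div_pos hP0' hX')).congr fun n => ?_
    have h1 : -(n : ℤ) * (-n - 1) / 2 = ((n.choose 2 + n : ℕ) : ℤ) := by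
      have h2 := triangle_natCast (n + 1)
      rw [Nat.choose_succ_succ' n 1, Nat.choose_one_right] at h2
      rw [add_comm, ← h2]
      push_cast
      ring_nf
    rw [thetaTerm, h1, zpow_neg, zpow_natCast, zpow_natCast]
    rw [norm_mul, norm_pow, norm_inv, norm_pow, pow_add, div_pow]
    ring

theorem tendsto_eulerFac (hp : ‖p‖ < 1) : Tendsto (eulerFac p) atTop (𝓝 (infFac p p)) :=
  (multipliable_infFac hp p).hasProd.tendsto_prod_nat

theorem infFac_self_ne_zero (hp : ‖p‖ < 1) : infFac p p ≠ 0 :=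
  infFac_ne_zero hp (mul_pow_ne_one_of_norm_lt_one hp)

theorem exists_norm_eulerFac_bounds (hp : ‖p‖ < 1) :
    ∃ C : ℝ, (∀ n, ‖eulerFac p n‖ ≤ C) ∧ ∀ n, ‖(eulerFac p n)⁻¹‖ ≤ C := by
  obtain ⟨C, hC⟩ := (tendsto_eulerFac hp).norm.bddAbove_range
  obtain ⟨D, hD⟩ := ((tendsto_eulerFac hp).inv₀ (infFac_self_ne_zero hp)).norm.bddAbove_range
  exact ⟨max C D, fun n => (hC ⟨n, rfl⟩).trans (le_max_left _ _),
    fun n => (hD ⟨n, rfl⟩).trans (le_max_right _ _)⟩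

/-- The finite form of the Jacobi triple product. -/
theorem finite_triple_product (hp : ‖p‖ < 1) (hp0 : p ≠ 0) {x : ℂ} (hx : x ≠ 0) (m : ℕ) :
    (∏ j ∈ range m, (1 - x * p ^ j)) * ∏ j ∈ range m, (1 - p / x * p ^ j)
      = ∑ i ∈ range (2 * m + 1), thetaTerm p (-x) ((i : ℤ) - m) * gaussBinom p (2 * m) i := by
  -- Replacing `x` by `x / p ^ m` centres the product: the last `m` factors are those of `x`, and
  -- the first `m`, reversed, are those of `p / x` times a monomial.
  have key := prod_one_sub_mul_pow hp (x / p ^ m) (2 * m)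
  rw [two_mul, prod_range_add, ← two_mul] at key
  have h1 : ∏ j ∈ range m, (1 - x / p ^ m * p ^ (m + j)) = ∏ j ∈ range m, (1 - x * p ^ j) :=
    prod_congr rfl fun j _ => by rw [pow_add]; field_simp
  have h2 : ∏ j ∈ range m, (1 - x / p ^ m * p ^ j)
      = (-x) ^ m * (p ^ ((m + 1).choose 2))⁻¹ * ∏ j ∈ range m, (1 - p / x * p ^ j) := by
    rw [← prod_range_reflect]
    have : ∀ j ∈ range m, 1 - x / p ^ m * p ^ (m - 1 - j)
        = -x * (p ^ (j + 1))⁻¹ * (1 - p / x * p ^ j) := by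
      intro j hj
      have hj := mem_range.1 hj
      have : p ^ m = p ^ (m - 1 - j) * p ^ (j + 1) := by rw [← pow_add]; congr 1; omega
      rw [this]
      field_simp
      ring
    rw [prod_congr rfl this, prod_mul_distrib, prod_mul_distrib, prod_const, card_range,
      prod_inv_distrib, prod_pow_eq_pow_sum]
    congr 4
    clear * -
    induction m with
    | zero => rfl
    | succ m ih =>
      rw [sum_range_succ, ih, Nat.choose_succ_succ' (m + 1) 1, Nat.choose_one_right, add_comm]
  rw [h1, h2] at key
  have h3 : (-x) ^ m * (p ^ ((m + 1).choose 2))⁻¹ ≠ 0 := by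
    have : -x ≠ 0 := neg_ne_zero.2 hx
    positivity
  refine mul_left_cancel₀ h3 ?_
  rw [mul_sum]
  calc _ = _ := by ring
    _ = _ := key
    _ = _ := sum_congr rfl fun i _ => ?_
  rw [← mul_assoc]
  congr 1
  rw [thetaTerm, zpow_sub₀ (neg_ne_zero.2 hx), neg_div', div_pow, ← pow_mul]
  have h4 : ((i : ℤ) - m) * ((i : ℤ) - m - 1) / 2
      = (i.choose 2 : ℕ) + ((m + 1).choose 2 : ℕ) - (m * i : ℕ) := by
    rw [← triangle_natCast, ← triangle_natCast]
    have a1 := two_mul_triangle ((i : ℤ) - m)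
    have a2 := two_mul_triangle i
    have a3 := two_mul_triangle ((m + 1 : ℕ))
    refine mul_left_cancel₀ (two_ne_zero (α := ℤ)) ?_
    push_cast at a3 ⊢
    linear_combination a1 - a2 - a3
  rw [h4, zpow_sub₀ hp0, zpow_add₀ hp0]
  simp only [zpow_natCast]
  have : -x ≠ 0 := neg_ne_zero.2 hx
  field_simp

end TripleProduct

/-! ### The Jacobi triple product and the rank-two property of theta products. -/

section TripleProductLimit

open Filter Topology

variable {p : ℂ}

theorem gaussBinom_norm_le {C : ℝ} (h1 : ∀ n, ‖eulerFac p n‖ ≤ C)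
    (h2 : ∀ n, ‖(eulerFac p n)⁻¹‖ ≤ C) (N i : ℕ) : ‖gaussBinom p N i‖ ≤ C * (C * C) := by
  have hC : 0 ≤ C := (norm_nonneg _).trans (h1 0)
  unfold gaussBinom
  split_ifs
  · rw [div_eq_mul_inv, mul_inv, norm_mul, norm_mul]
    gcongr
    · exact h1 _
    · exact h2 _
    · exact h2 _
  · rw [norm_zero]
    positivity

/-- The Jacobi triple product identity. -/
theorem theta_mul_infFac_eq_tsum (hp : ‖p‖ < 1) (hp0 : p ≠ 0) {x : ℂ} (hx : x ≠ 0) :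
    theta p x = (∑' k, thetaTerm p (-x) k) * (infFac p p)⁻¹ := by
  -- Extension by zero makes the finite sums series over `ℤ`. The Gaussian binomials are uniformly
  -- bounded and tend to `1 / (p; p)_∞`, so dominated convergence applies.
  let F : ℕ → ℤ → ℂ := fun m k =>
    if -(m : ℤ) ≤ k ∧ k ≤ m then thetaTerm p (-x) k * gaussBinom p (2 * m) (k + m).toNat else 0
  have hF (m : ℕ) : ∑' k, F m k
      = (∏ j ∈ range m, (1 - x * p ^ j)) * ∏ j ∈ range m, (1 - p / x * p ^ j) := by
    rw [finite_triple_product hp hp0 hx,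
      tsum_eq_sum (s := (range (2 * m + 1)).image fun i : ℕ => (i : ℤ) - m)]
    · rw [sum_image (fun a _ b _ h => by simpa using h)]
      refine sum_congr rfl fun i hi => ?_
      have hi := mem_range.1 hi
      simp only [F]
      rw [if_pos (by omega)]
      congr 2
      omega
    · intro k hk
      refine if_neg fun hk' => hk (mem_image.2 ⟨(k + m).toNat, mem_range.2 (by omega), by omega⟩)
  obtain ⟨C, hC1, hC2⟩ := exists_norm_eulerFac_bounds hp
  have hlim1 : Tendsto (fun m => ∑' k, F m k) atTop (𝓝 (theta p x)) := by
    simp only [hF]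
    exact (multipliable_infFac hp x).hasProd.tendsto_prod_nat.mul
      (multipliable_infFac hp (p / x)).hasProd.tendsto_prod_nat
  have hlim2 : Tendsto (fun m => ∑' k, F m k) atTop
      (𝓝 (∑' k, thetaTerm p (-x) k * (infFac p p)⁻¹)) := by
    refine tendsto_tsum_of_dominated_convergence
      (bound := fun k => ‖thetaTerm p (-x) k‖ * (C * (C * C)))
      ((summable_norm_thetaTerm hp0 hp (neg_ne_zero.2 hx)).mul_right _) (fun k => ?_)
      (Eventually.of_forall fun m k => ?_)
    · have h1 : Tendsto (fun m : ℕ => thetaTerm p (-x) k * (eulerFac p (2 * m)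
          / (eulerFac p (k + m).toNat * eulerFac p (2 * m - (k + m).toNat)))) atTop
          (𝓝 (thetaTerm p (-x) k * (infFac p p / (infFac p p * infFac p p)))) := by
        have hE := tendsto_eulerFac hp
        have h0 := infFac_self_ne_zero hp
        refine tendsto_const_nhds.mul (Tendsto.div (hE.comp ?_) (Tendsto.mul (hE.comp ?_)
          (hE.comp ?_)) (mul_ne_zero h0 h0))
        · exact tendsto_atTop_mono (fun m => Nat.le_mul_of_pos_left m two_pos) tendsto_id
        · refine tendsto_atTop_atTop.2 fun b => ⟨b + k.natAbs, fun m hm => by omega⟩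
        · refine tendsto_atTop_atTop.2 fun b => ⟨b + k.natAbs, fun m hm => by omega⟩
      have h2 : infFac p p / (infFac p p * infFac p p) = (infFac p p)⁻¹ := by
        have h0 := infFac_self_ne_zero hp
        field_simp
      rw [h2] at h1
      refine h1.congr' ?_
      filter_upwards [eventually_ge_atTop k.natAbs] with m hm
      simp only [F]
      rw [if_pos (by omega), gaussBinom, if_pos (by omega)]
    · simp only [F]
      split_ifs
      · rw [norm_mul]
        gcongr
        exact gaussBinom_norm_le hC1 hC2 _ _
      · rw [norm_zero]
        have : 0 ≤ C := (norm_nonneg _).trans (hC1 0)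
        positivity
  rw [tendsto_nhds_unique hlim1 hlim2, tsum_mul_right]

/-- The decomposition of `ℤ × ℤ` according to the parity of the sum of the coordinates. -/
def parityEquiv : (ℤ × ℤ) ⊕ (ℤ × ℤ) ≃ ℤ × ℤ :=
  Equiv.ofBijective
    (Sum.elim (fun s => (s.1 + s.2, s.1 - s.2)) fun s => (s.1 + s.2 + 1, s.1 - s.2)) (by
      constructor
      · rintro (⟨a, b⟩ | ⟨a, b⟩) (⟨c, d⟩ | ⟨c, d⟩) h <;>
          simp only [Sum.elim_inl, Sum.elim_inr, Prod.mk.injEq] at h <;>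
          simp only [Sum.inl.injEq, Sum.inr.injEq, Prod.mk.injEq, reduceCtorEq] <;> omega
      · rintro ⟨m, n⟩
        rcases Int.even_or_odd' (m + n) with ⟨s, h | h⟩
        · exact ⟨Sum.inl (s, m - s), by simp; omega⟩
        · exact ⟨Sum.inr (s, m - s - 1), by simp; omega⟩)

theorem neg_mul_zpow_mul_neg_div_zpow {x y : ℂ} (hx : x ≠ 0) (hy : y ≠ 0) (s t : ℤ) :
    (-(x * y)) ^ (s + t) * (-(x / y)) ^ (s - t) = (x ^ 2) ^ s * (y ^ 2) ^ t := by
  have hn : (-1 : ℂ) ^ (s + t) * (-1) ^ (s - t) = 1 := by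
    rw [← zpow_add₀ (by simp), show s + t + (s - t) = 2 * s by ring, zpow_mul]
    simp
  rw [neg_eq_neg_one_mul (x * y), neg_eq_neg_one_mul (x / y), mul_zpow, mul_zpow, mul_zpow,
    div_zpow, zpow_add₀ hx, zpow_sub₀ hx, zpow_add₀ hy, zpow_sub₀ hy, ← zpow_natCast,
    ← zpow_natCast, ← zpow_mul, ← zpow_mul, mul_comm (_ : ℤ) s, mul_comm (_ : ℤ) t,
    zpow_mul, zpow_mul]
  norm_cast
  push_cast
  rw [sq, sq]
  field_simp
  linear_combination hn

/-- The substitution `(s + t, s - t)` diagonalises the quadratic exponent, so the even class of the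
double series separates into a series in `x` times a series in `y`, both in base `p ^ 2`. -/
theorem thetaTerm_even (hp0 : p ≠ 0) {x y : ℂ} (hx : x ≠ 0) (hy : y ≠ 0) (s t : ℤ) :
    thetaTerm p (-(x * y)) (s + t) * thetaTerm p (-(x / y)) (s - t)
      = thetaTerm (p ^ 2) (x ^ 2) s * thetaTerm (p ^ 2) (p * y ^ 2) t := by
  have e : (s + t) * (s + t - 1) / 2 + (s - t) * (s - t - 1) / 2
      = 2 * (s * (s - 1) / 2) + (2 * (t * (t - 1) / 2) + t) := by
    have h1 := two_mul_triangle (s + t)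
    have h2 := two_mul_triangle (s - t)
    have h3 := two_mul_triangle s
    have h4 := two_mul_triangle t
    refine mul_left_cancel₀ (two_ne_zero (α := ℤ)) ?_
    linear_combination h1 + h2 - 2 * h3 - 2 * h4
  have h1 := neg_mul_zpow_mul_neg_div_zpow hx hy s t
  unfold thetaTerm
  rw [mul_zpow p, ← zpow_natCast p 2, ← zpow_mul, ← zpow_mul]
  calc _ = p ^ ((s + t) * (s + t - 1) / 2 + (s - t) * (s - t - 1) / 2)
        * ((-(x * y)) ^ (s + t) * (-(x / y)) ^ (s - t)) := by
        rw [zpow_add₀ hp0]; ring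
    _ = _ := by
        rw [e, h1, zpow_add₀ hp0, zpow_add₀ hp0]
        push_cast
        ring

/-- The odd class separates too, with the two base `p ^ 2` series interchanged; this gives the
second term of the antisymmetric form. -/
theorem thetaTerm_odd (hp0 : p ≠ 0) {x y : ℂ} (hx : x ≠ 0) (hy : y ≠ 0) (s t : ℤ) :
    thetaTerm p (-(x * y)) (s + t + 1) * thetaTerm p (-(x / y)) (s - t)
      = -(x / y) * (thetaTerm (p ^ 2) (p * x ^ 2) s * thetaTerm (p ^ 2) (y ^ 2) (t + 1)) := by
  have e : (s + t + 1) * (s + t + 1 - 1) / 2 + (s - t) * (s - t - 1) / 2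
      = (2 * (s * (s - 1) / 2) + s) + 2 * ((t + 1) * (t + 1 - 1) / 2) := by
    have h1 := two_mul_triangle (s + t + 1)
    have h2 := two_mul_triangle (s - t)
    have h3 := two_mul_triangle s
    have h4 := two_mul_triangle (t + 1)
    refine mul_left_cancel₀ (two_ne_zero (α := ℤ)) ?_
    linear_combination h1 + h2 - 2 * h3 - 2 * h4
  have h1 := neg_mul_zpow_mul_neg_div_zpow hx hy s t
  unfold thetaTerm
  rw [mul_zpow p, ← zpow_natCast p 2, ← zpow_mul, ← zpow_mul]
  calc _ = p ^ ((s + t + 1) * (s + t + 1 - 1) / 2 + (s - t) * (s - t - 1) / 2)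
        * ((-(x * y)) ^ (s + t) * (-(x / y)) ^ (s - t)) * -(x * y) := by
        rw [zpow_add₀ hp0, zpow_add_one₀ (neg_ne_zero.2 (mul_ne_zero hx hy)) (s + t)]; ring
    _ = _ := by
        rw [e, h1, zpow_add₀ hp0, zpow_add₀ hp0, zpow_add_one₀ (pow_ne_zero 2 hy)]
        push_cast
        field_simp

/-- The functions `x ↦ θ(xy)θ(x/y)` span a space of rank two. -/
theorem exists_theta_mul_theta_div (hp : ‖p‖ < 1) :
    ∃ A B : ℂ → ℂ, ∀ x y, x ≠ 0 → y ≠ 0 →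
      theta p (x * y) * theta p (x / y) = x * (A x * B y - B x * A y) := by
  -- The series representation needs `p ≠ 0`. For `p = 0`, `θ(a) = 1 - a` and the decomposition is
  -- elementary.
  rcases eq_or_ne p 0 with rfl | hp0
  · refine ⟨fun x => x + x⁻¹, fun _ => 1, fun x y hx hy => ?_⟩
    have h0 : infFac (0 : ℂ) 0 = 1 := by simp [infFac]
    have h (a : ℂ) : theta 0 a = 1 - a := by
      rw [theta, zero_div, h0, infFac_eq_mul (by simp), mul_zero, h0, mul_one, mul_one]
    rw [h, h]
    field_simp
    ring
  · let S : ℂ → ℂ → ℂ := fun P X => ∑' k, thetaTerm P X k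
    refine ⟨fun x => (infFac p p)⁻¹ ^ 2 * (S (p ^ 2) (x ^ 2) / x), fun x => S (p ^ 2) (p * x ^ 2),
      fun x y hx hy => ?_⟩
    rw [theta_mul_infFac_eq_tsum hp hp0 (mul_ne_zero hx hy),
      theta_mul_infFac_eq_tsum hp hp0 (div_ne_zero hx hy)]
    have hP0 : p ^ 2 ≠ 0 := pow_ne_zero 2 hp0
    have hP : ‖p ^ 2‖ < 1 := by
      rw [norm_pow]; exact pow_lt_one₀ (norm_nonneg p) hp two_ne_zero
    have sA {z : ℂ} (hz : z ≠ 0) := summable_norm_thetaTerm hP0 hP (pow_ne_zero 2 hz)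
    have sB {z : ℂ} (hz : z ≠ 0) :=
      summable_norm_thetaTerm hP0 hP (mul_ne_zero hp0 (pow_ne_zero 2 hz))
    have sT {z : ℂ} (hz : z ≠ 0) := summable_norm_thetaTerm hp0 hp (neg_ne_zero.2 hz)
    have sA' : Summable fun t : ℤ => ‖thetaTerm (p ^ 2) (y ^ 2) (t + 1)‖ :=
      (Equiv.addRight (1 : ℤ)).summable_iff.2 (sA hy)
    have hA' : ∑' t : ℤ, thetaTerm (p ^ 2) (y ^ 2) (t + 1) = S (p ^ 2) (y ^ 2) :=
      (Equiv.addRight (1 : ℤ)).tsum_eq fun t => thetaTerm (p ^ 2) (y ^ 2) t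
    have key : S p (-(x * y)) * S p (-(x / y))
        = S (p ^ 2) (x ^ 2) * S (p ^ 2) (p * y ^ 2)
          - x / y * (S (p ^ 2) (p * x ^ 2) * S (p ^ 2) (y ^ 2)) := by
      rw [← hA']
      simp only [S]
      rw [tsum_mul_tsum_of_summable_norm (sT (mul_ne_zero hx hy)) (sT (div_ne_zero hx hy)),
        tsum_mul_tsum_of_summable_norm (sA hx) (sB hy),
        tsum_mul_tsum_of_summable_norm (sB hx) sA', ← parityEquiv.tsum_eq]
      have hs := parityEquiv.summable_iff.2
        (summable_mul_of_summable_norm (sT (mul_ne_zero hx hy)) (sT (div_ne_zero hx hy)))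
      refine (Summable.tsum_sum (hs.comp_injective Sum.inl_injective)
        (hs.comp_injective Sum.inr_injective)).trans ?_
      rw [sub_eq_add_neg, ← neg_mul (x / y), ← tsum_mul_left]
      exact congrArg₂ _ (tsum_congr fun z => thetaTerm_even hp0 hx hy z.1 z.2)
        (tsum_congr fun z => thetaTerm_odd hp0 hx hy z.1 z.2)
    change S p (-(x * y)) * _ * (S p (-(x / y)) * _) = _
    rw [mul_mul_mul_comm, key]
    field_simp

end TripleProductLimit

/-! ### Interpolation by theta functions. -/

section Interpolation

open Polynomial

variable {p : ℂ}

theorem countable_theta_mul_zeros (hp : ‖p‖ < 1) {c : ℂ} (hc : c ≠ 0) :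
    {e : ℂ | theta p (c * e) = 0}.Countable :=
  (countable_theta_zeros hp).preimage (mul_right_injective₀ hc)

theorem countable_theta_div_zeros (hp : ‖p‖ < 1) {c : ℂ} (hc : c ≠ 0) :
    {e : ℂ | theta p (c / e) = 0}.Countable :=
  (countable_theta_zeros hp).preimage fun a b h =>
    inv_injective (mul_right_injective₀ hc (by simpa [div_eq_mul_inv] using h))

theorem exists_notMem_of_countable {s : Set ℂ} (hs : s.Countable) : ∃ e, e ∉ s :=
  (hs.dense_compl ℂ).nonempty

/-- On a finite set of nodes, the functions `c ↦ θ(cu)θ(Cu/c)` are, up to a common nonvanishing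
factor, affine functions of a single coordinate that separates the nodes. -/
theorem exists_affine_coordinate (hp : ‖p‖ < 1) {C : ℂ} (hC : C ≠ 0) (S : Finset ℂ)
    (hS : ∀ c ∈ S, c ≠ 0) :
    ∃ X w : ℂ → ℂ, (∀ c ∈ S, w c ≠ 0) ∧
      (∀ u, u ≠ 0 → ∃ α β, ∀ c ∈ S,
        theta p (c * u) * theta p (C * u / c) = w c * (α * X c + β)) ∧
      ∀ c ∈ S, ∀ d ∈ S, X c = X d → theta p (c / d) * theta p (c * d / C) = 0 := by
  obtain ⟨A, B, hAB⟩ := exists_theta_mul_theta_div hp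
  -- A square root `g` of `C` gives `cu = (gu)(c/g)` and `Cu/c = (gu)/(c/g)`, the shape required by
  -- the rank-two property.
  obtain ⟨g, hg⟩ := IsSquare.exists_sq C (IsAlgClosed.exists_pow_nat_eq C two_pos |>.imp
    fun z hz => by rw [← hz, sq])
  have hg0 : g ≠ 0 := by rintro rfl; exact hC (by simpa using hg)
  have hform (c u : ℂ) (hc : c ≠ 0) (hu : u ≠ 0) : theta p (c * u) * theta p (C * u / c)
      = g * u * (A (g * u) * B (c / g) - B (g * u) * A (c / g)) := by
    rw [← hAB (g * u) (c / g) (mul_ne_zero hg0 hu) (div_ne_zero hc hg0), hg]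
    congr 2 <;> field_simp
  obtain ⟨e, he⟩ := exists_notMem_of_countable
    (s := {0} ∪ ⋃ c ∈ S, ({e | theta p (c * e) = 0} ∪ {e | theta p (C / c * e) = 0}))
    (.union (Set.countable_singleton 0) (Set.Countable.biUnion S.countable_toSet fun c hc =>
      .union (countable_theta_mul_zeros hp (hS c hc))
        (countable_theta_mul_zeros hp (div_ne_zero hC (hS c hc)))))
  simp only [Set.mem_union, Set.mem_singleton_iff, Set.mem_iUnion, Set.mem_ofPred_eq, not_or,
    not_exists] at he
  obtain ⟨he0, he⟩ := he
  -- The choice of `e` makes its theta product nonzero on `S`; `e'` is chosen so that the vectors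
  -- `(A, B)` at `g e` and `g e'` are independent. The coordinate `X` is the quotient of the two
  -- resulting basis functions.
  obtain ⟨e', he'⟩ := exists_notMem_of_countable
    (s := {0} ∪ ({e' | theta p (C * e * e') = 0} ∪ {e' | theta p (e / e') = 0}))
    (.union (Set.countable_singleton 0) (.union
      (countable_theta_mul_zeros hp (mul_ne_zero hC he0)) (countable_theta_div_zeros hp he0)))
  simp only [Set.mem_union, Set.mem_singleton_iff, Set.mem_ofPred_eq, not_or] at he'
  obtain ⟨he0', h1, h2⟩ := he'
  have hD : A (g * e) * B (g * e') - B (g * e) * A (g * e') ≠ 0 := by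
    intro h
    have := hAB (g * e) (g * e') (mul_ne_zero hg0 he0) (mul_ne_zero hg0 he0')
    rw [h, mul_zero, mul_div_mul_left _ _ hg0, show g * e * (g * e') = C * e * e' by rw [hg]; ring]
      at this
    exact mul_ne_zero h1 h2 this
  let w (e c : ℂ) : ℂ := theta p (c * e) * theta p (C * e / c)
  have hw (c : ℂ) (hc : c ∈ S) : w e c ≠ 0 := by
    have := he c hc
    exact mul_ne_zero this.1 (by rw [mul_div_right_comm]; exact this.2)
  refine ⟨fun c => w e' c / w e c, w e, hw, fun u hu => ?_, fun c hc d hd h => ?_⟩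
  · refine ⟨u * (A (g * e) * B (g * u) - B (g * e) * A (g * u))
        / (e' * (A (g * e) * B (g * e') - B (g * e) * A (g * e'))),
      u * (A (g * u) * B (g * e') - B (g * u) * A (g * e'))
        / (e * (A (g * e) * B (g * e') - B (g * e) * A (g * e'))), fun c hc => ?_⟩
    have h3 : w e c * (w e' c / w e c) = w e' c := mul_div_cancel₀ _ (hw c hc)
    rw [mul_add, mul_left_comm, h3]
    simp only [w]
    rw [hform c u (hS c hc) hu, hform c e (hS c hc) he0, hform c e' (hS c hc) he0']
    field_simp
    ring
  · rw [div_eq_div_iff (hw c hc) (hw d hd)] at h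
    simp only [w] at h
    have hc0 := hS c hc
    have hd0 := hS d hd
    rw [hform c e hc0 he0, hform c e' hc0 he0', hform d e hd0 he0, hform d e' hd0 he0'] at h
    -- Multiplicativity of `2 × 2` determinants: equal coordinates at `c` and `d` force the
    -- determinant at `c / g`, `d / g` to vanish.
    have h4 : (g * e) * (g * e') * (A (g * e) * B (g * e') - B (g * e) * A (g * e'))
        * (A (c / g) * B (d / g) - B (c / g) * A (d / g)) = 0 := by
      linear_combination -h
    have h5 := (mul_eq_zero.1 h4).resolve_left (by simp [hg0, he0, he0', hD])
    have h6 := hAB (c / g) (d / g) (div_ne_zero hc0 hg0) (div_ne_zero hd0 hg0)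
    rw [h5, mul_zero, div_div_div_cancel_right₀ hg0] at h6
    rw [mul_comm, ← h6, hg]
    congr 2
    field_simp

/-- The function `f` agrees on `S` with `w ^ L` times a polynomial of degree at most `L` in `X`. -/
def IsForm (S : Finset ℂ) (X w : ℂ → ℂ) (L : ℕ) (f : ℂ → ℂ) : Prop :=
  ∃ P : ℂ[X], P.natDegree ≤ L ∧ ∀ c ∈ S, f c = w c ^ L * P.eval (X c)

variable {S : Finset ℂ} {X w : ℂ → ℂ} {L M : ℕ} {f g : ℂ → ℂ}

theorem IsForm.add (hf : IsForm S X w L f) (hg : IsForm S X w L g) :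
    IsForm S X w L fun c => f c + g c := by
  obtain ⟨P, hP, hPf⟩ := hf
  obtain ⟨Q, hQ, hQg⟩ := hg
  exact ⟨P + Q, natDegree_add_le_of_degree_le hP hQ, fun c hc => by
    beta_reduce
    rw [hPf c hc, hQg c hc, eval_add, mul_add]⟩

theorem IsForm.mul (hf : IsForm S X w L f) (hg : IsForm S X w M g) :
    IsForm S X w (L + M) fun c => f c * g c := by
  obtain ⟨P, hP, hPf⟩ := hf
  obtain ⟨Q, hQ, hQg⟩ := hg
  exact ⟨P * Q, natDegree_mul_le_of_le hP hQ, fun c hc => by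
    beta_reduce
    rw [hPf c hc, hQg c hc, eval_mul, pow_add]; ring⟩

theorem isForm_const (k : ℂ) : IsForm S X w 0 fun _ => k :=
  ⟨Polynomial.C k, by simp, by simp⟩

theorem IsForm.const_mul (k : ℂ) (hf : IsForm S X w L f) : IsForm S X w L fun c => k * f c := by
  simpa using (isForm_const k).mul hf

theorem isForm_zero : IsForm S X w L fun _ => 0 := ⟨0, by simp, by simp⟩

theorem isForm_sum {ι : Type*} (s : Finset ι) (f : ι → ℂ → ℂ)
    (h : ∀ i ∈ s, IsForm S X w L (f i)) : IsForm S X w L fun c => ∑ i ∈ s, f i c := by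
  classical
  induction s using Finset.induction_on with
  | empty => simpa using isForm_zero
  | insert i s hi ih =>
    simp only [sum_insert hi]
    exact (h i (mem_insert_self i s)).add (ih fun j hj => h j (mem_insert_of_mem hj))

theorem isForm_prod {ι : Type*} (s : Finset ι) (L : ι → ℕ) (f : ι → ℂ → ℂ)
    (h : ∀ i ∈ s, IsForm S X w (L i) (f i)) :
    IsForm S X w (∑ i ∈ s, L i) fun c => ∏ i ∈ s, f i c := by
  classical
  induction s using Finset.induction_on with
  | empty => simpa using isForm_const 1
  | insert i s hi ih =>
    simp only [prod_insert hi, sum_insert hi]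
    exact (h i (mem_insert_self i s)).mul (ih fun j hj => h j (mem_insert_of_mem hj))

/-- A polynomial of degree at most `L` with more than `L` distinct roots is zero. -/
theorem IsForm.eq_zero {ι : Type*} [Fintype ι] (hf : IsForm S X w L f)
    (hw : ∀ c ∈ S, w c ≠ 0) (d : ι → ℂ) (hd : ∀ i, d i ∈ S) (hinj : Function.Injective (X ∘ d))
    (hcard : L < Fintype.card ι) (hzero : ∀ i, f (d i) = 0) {c : ℂ} (hc : c ∈ S) : f c = 0 := by
  obtain ⟨P, hP, hPf⟩ := hf
  have : P = 0 := by
    refine eq_zero_of_natDegree_lt_card_of_eval_eq_zero P hinj (fun i => ?_) (hP.trans_lt hcard)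
    have := hPf (d i) (hd i)
    rw [hzero i] at this
    exact (mul_eq_zero.1 this.symm).resolve_left (pow_ne_zero _ (hw _ (hd i)))
  rw [hPf c hc, this, eval_zero, mul_zero]

end Interpolation

/-! ### Shifted factorials and multi-index identities. -/

section ShiftedFactorials

/-- The shifted factorial `(a; q, p)_k` for `k : ℕ`. -/
def thetaPoch (q p a : ℂ) (k : ℕ) : ℂ := ∏ j ∈ range k, theta p (a * q ^ j)

variable {q p : ℂ}

theorem ellFac_natCast (a : ℂ) (k : ℕ) : ellFac q p a (k : ℤ) = thetaPoch q p a k := rfl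

@[simp]
theorem thetaPoch_zero (a : ℂ) : thetaPoch q p a 0 = 1 := rfl

theorem thetaPoch_add (a : ℂ) (m k : ℕ) :
    thetaPoch q p a (m + k) = thetaPoch q p a m * thetaPoch q p (a * q ^ m) k := by
  simp only [thetaPoch, prod_range_add, pow_add, mul_assoc]

theorem thetaPoch_succ' (a : ℂ) (k : ℕ) :
    thetaPoch q p a (k + 1) = theta p a * thetaPoch q p (a * q) k := by
  rw [add_comm, thetaPoch_add]
  simp [thetaPoch]

theorem thetaPoch_ne_zero {a : ℂ} (h : ∀ m : ℕ, theta p (a * q ^ m) ≠ 0) (k : ℕ) :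
    thetaPoch q p a k ≠ 0 :=
  prod_ne_zero_iff.2 fun j _ => h j

theorem thetaPoch_eq_zero (hp : ‖p‖ < 1) {a : ℂ} {i k : ℕ} (hi : i < k) (h : a * q ^ i = 1) :
    thetaPoch q p a k = 0 :=
  prod_eq_zero (mem_range.2 hi) (by rw [h, theta_one hp])

theorem size_add {n : ℕ} (j k : MIdx n) : size (j + k) = size j + size k := sum_add_distrib

theorem prod_prod_eq_diag_mul {n : ℕ} (f : Fin n → Fin n → ℂ) :
    ∏ r, ∏ s, f r s = (∏ r, f r r) * ∏ r, ∏ s ∈ Ioi r, f s r * f r s := by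
  rw [prod_prod_Ioi_mul_eq_prod_prod_off_diag, prod_comm, ← prod_mul_distrib]
  exact prod_congr rfl fun r _ => (Fintype.prod_eq_mul_prod_compl r _)

theorem sum_sum_eq_diag_add {n : ℕ} (f : Fin n → Fin n → ℕ) :
    ∑ r, ∑ s, f r s = (∑ r, f r r) + ∑ r, ∑ s ∈ Ioi r, (f s r + f r s) := by
  rw [sum_sum_Ioi_add_eq_sum_sum_off_diag, sum_comm, ← sum_add_distrib]
  exact sum_congr rfl fun r _ => (Fintype.sum_eq_add_sum_compl r _)

/-- The off-diagonal part of `|j| |k|` is the polarisation of `pairSum`. The diagonal part matches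
the powers of `q` from `(x_r q^{j_r})^{k_r}`, and `|j| |k|` matches those from replacing `β` by `β
q^{|j|}`. -/
theorem pairSum_add_add {n : ℕ} (j k : MIdx n) :
    pairSum (j + k) + ∑ r, j r * k r = pairSum j + pairSum k + size j * size k := by
  rw [size, size, sum_mul_sum, sum_sum_eq_diag_add, add_left_comm, add_comm _ (∑ r, j r * k r)]
  congr 1
  simp only [pairSum, ← sum_add_distrib]
  refine sum_congr rfl fun r _ => sum_congr rfl fun s _ => ?_
  simp only [Pi.add_apply]
  ring

end ShiftedFactorials

/-! ### The Jackson summand and its behaviour under shifts of the indices. -/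

section KeyTerm

variable {n : ℕ}

/-- The part of the summand that depends on one of the three free parameters. -/
def paramPart (q p : ℂ) (x : Fin n → ℂ) (β : ℂ) (N k : MIdx n) (c : ℂ) : ℂ :=
  thetaPoch q p (β * q / c) (size k)
    * ∏ r, thetaPoch q p (c * x r * q ^ k r) (N r - k r)

/-- The part of the summand with poles at the points `x_s`. -/
def polePart (q p : ℂ) (x : Fin n → ℂ) (β : ℂ) (k : MIdx n) : ℂ :=
  ∏ r, (thetaPoch q p (β * x r) (size k) / ∏ s, thetaPoch q p (q * (x r / x s)) (k r))

/-- The part of the summand that is covariant under shifts of the multi-indices. -/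
def shiftPart (q p : ℂ) (x : Fin n → ℂ) (b β : ℂ) (N k : MIdx n) : ℂ :=
  (∏ r, (theta p (β * x r * q ^ (k r + size k)) / thetaPoch q p (β * x r) (N r + size k + 1)
      * thetaPoch q p (b * x r * q ^ k r / (β * q ^ size k)) (N r - k r)))
    * ((∏ r, ∏ s, thetaPoch q p (b * x r * x s) (N s + k r))
      / ((∏ r, ∏ s ∈ Ioi r, thetaPoch q p (b * x r * x s) (k r + k s))
        * ∏ r, ∏ s, thetaPoch q p (q ^ (1 + (k r : ℤ) - k s) * (x r / x s)) (N r - k r)))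
    * ((b / β) ^ size k * (∏ r, x r ^ k r) * (q ^ pairSum k)⁻¹)

/-- The summand of the `D_n` elliptic Jackson summation. -/
def jacksonTerm (q p : ℂ) (x : Fin n → ℂ) (b β c₁ c₂ c₃ : ℂ) (N k : MIdx n) : ℂ :=
  paramPart q p x β N k c₁ * paramPart q p x β N k c₂ * paramPart q p x β N k c₃
    * shiftPart q p x b β N k * polePart q p x β k

/-- The value of the `D_n` elliptic Jackson summation. -/
def jacksonValue (q p : ℂ) (x : Fin n → ℂ) (b c₁ c₂ c₃ : ℂ) (N : MIdx n) : ℂ :=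
  ∏ r, (thetaPoch q p (b * q * x r / c₁) (N r) * thetaPoch q p (b * q * x r / c₂) (N r)
    * thetaPoch q p (b * q * x r / c₃) (N r)
    * ∏ s, (thetaPoch q p (b * x r * x s) (N r) / thetaPoch q p (q * (x r / x s)) (N r)))

/-- The constant factor produced by shifting the multi-indices of `shiftPart` by `j`. -/
def shiftConst (q p : ℂ) (x : Fin n → ℂ) (b β : ℂ) (j : MIdx n) : ℂ :=
  (∏ r, (thetaPoch q p (β * x r) (j r + size j))⁻¹)
    * ((∏ r, ∏ s, thetaPoch q p (b * x r * x s) (j s + j r))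
      / ∏ r, ∏ s ∈ Ioi r, thetaPoch q p (b * x r * x s) (j r + j s))
    * ((b / β) ^ size j * (∏ r, x r ^ j r) * (q ^ pairSum j)⁻¹)

/-- The shifted variables `x_r q^{j_r}`. -/
def shiftVar (q : ℂ) (x : Fin n → ℂ) (j : MIdx n) (r : Fin n) : ℂ := x r * q ^ j r

variable {q p : ℂ} {x : Fin n → ℂ} {b β : ℂ}

theorem paramPart_shift (j M k : MIdx n) (c : ℂ) :
    paramPart q p x β (j + M) (j + k) c
      = thetaPoch q p (β * q / c) (size j)
        * paramPart q p (shiftVar q x j) (β * q ^ size j) M k c := by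
  simp only [paramPart, size_add, thetaPoch_add, shiftVar, Pi.add_apply, Nat.add_sub_add_left,
    pow_add, mul_assoc]
  congr 3
  ring

/-- Self-similarity of the summand: each shifted factorial splits off an initial segment independent
of `k` and `M`, leaving the same expression in `x_r q^{j_r}` and `β q^{|j|}`. Used both in the
induction for the Jackson sum and in the Bailey lemma. -/
theorem shiftPart_shift (hq : q ≠ 0) (hx : ∀ r, x r ≠ 0) (j M k : MIdx n) :
    shiftPart q p x b β (j + M) (j + k)
      = shiftConst q p x b β j * shiftPart q p (shiftVar q x j) b (β * q ^ size j) M k := by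
  have e1 (r : Fin n) : thetaPoch q p (β * x r) ((j + M) r + size (j + k) + 1)
      = thetaPoch q p (β * x r) (j r + size j)
        * thetaPoch q p (β * q ^ size j * shiftVar q x j r) (M r + size k + 1) := by
    rw [size_add, Pi.add_apply,
      show j r + M r + (size j + size k) + 1 = (j r + size j) + (M r + size k + 1) by ring,
      thetaPoch_add]
    congr 2
    rw [shiftVar]; ring
  have e2 (r : Fin n) : β * x r * q ^ ((j + k) r + size (j + k))
      = β * q ^ size j * shiftVar q x j r * q ^ (k r + size k) := by
    rw [size_add, Pi.add_apply, shiftVar]; ring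
  have e3 (r : Fin n) : b * x r * q ^ (j + k) r / (β * q ^ size (j + k))
      = b * shiftVar q x j r * q ^ k r / (β * q ^ size j * q ^ size k) := by
    rw [size_add, Pi.add_apply, shiftVar, pow_add, pow_add]; ring
  have e4 (r : Fin n) : (j + M) r - (j + k) r = M r - k r := Nat.add_sub_add_left _ _ _
  have e5 (r s : Fin n) (u v : MIdx n) : thetaPoch q p (b * x r * x s) ((j + u) s + (j + v) r)
      = thetaPoch q p (b * x r * x s) (j s + j r)
        * thetaPoch q p (b * shiftVar q x j r * shiftVar q x j s) (u s + v r) := by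
    rw [Pi.add_apply, Pi.add_apply, show j s + u s + (j r + v r) = (j s + j r) + (u s + v r) by ring,
      thetaPoch_add]
    congr 2
    rw [shiftVar, shiftVar]; ring
  have e6 (r s : Fin n) : thetaPoch q p (b * x r * x s) ((j + k) r + (j + k) s)
      = thetaPoch q p (b * x r * x s) (j r + j s)
        * thetaPoch q p (b * shiftVar q x j r * shiftVar q x j s) (k r + k s) := by
    rw [add_comm, e5, add_comm (j s), add_comm (k s)]
  have e7 (r s : Fin n) : q ^ (1 + ((j + k) r : ℤ) - ((j + k) s : ℕ)) * (x r / x s)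
      = q ^ (1 + (k r : ℤ) - k s) * (shiftVar q x j r / shiftVar q x j s) := by
    have := hx s
    simp only [Pi.add_apply, Nat.cast_add, shiftVar]
    rw [show (1 + ((j r : ℤ) + k r) - (j s + k s)) = (1 + (k r : ℤ) - k s) + (j r : ℤ) - j s by ring,
      zpow_sub₀ hq, zpow_add₀ hq, zpow_natCast, zpow_natCast]
    field_simp
  have e8 : (b / β) ^ size (j + k) * (∏ r, x r ^ (j + k) r) * (q ^ pairSum (j + k))⁻¹
      = ((b / β) ^ size j * (∏ r, x r ^ j r) * (q ^ pairSum j)⁻¹)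
        * ((b / (β * q ^ size j)) ^ size k * (∏ r, shiftVar q x j r ^ k r)
          * (q ^ pairSum k)⁻¹) := by
    have h1 : ∏ r, shiftVar q x j r ^ k r = (∏ r, x r ^ k r) * q ^ ∑ r, j r * k r := by
      rw [← prod_pow_eq_pow_sum, ← prod_mul_distrib]
      exact prod_congr rfl fun r _ => by rw [shiftVar, mul_pow, pow_mul]
    have h2 : q ^ pairSum (j + k) * q ^ (∑ r, j r * k r)
        = q ^ pairSum j * q ^ pairSum k * (q ^ size j) ^ size k := by
      rw [← pow_add, pairSum_add_add, pow_add, pow_add, pow_mul]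
    have h3 : (q ^ pairSum (j + k))⁻¹ = (q ^ pairSum j)⁻¹ * (q ^ pairSum k)⁻¹
        * ((q ^ size j) ^ size k)⁻¹ * q ^ (∑ r, j r * k r) := by
      field_simp
      linear_combination -h2
    rw [h1, h3, size_add]
    simp only [Pi.add_apply, pow_add, prod_mul_distrib]
    rw [← div_div, div_pow _ (q ^ size j)]
    ring
  unfold shiftPart shiftConst
  rw [e8]
  simp only [e1, e2, e3, e4, e5, e6, e7, prod_mul_distrib, prod_div_distrib, prod_inv_distrib]
  ring

end KeyTerm

/-! ### Reduction of summand and value at the nodes `(x_r q^m)⁻¹`. -/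

section NodeReduction

variable {n : ℕ} {q p : ℂ} {x : Fin n → ℂ} {b β : ℂ}

theorem size_single (r : Fin n) (m : ℕ) : size (Pi.single r m) = m := by
  simp [size]

theorem pairSum_single (r : Fin n) (m : ℕ) : pairSum (Pi.single r m) = 0 := by
  refine sum_eq_zero fun u _ => sum_eq_zero fun v hv => ?_
  rcases eq_or_ne u r with rfl | h
  · rw [Pi.single_eq_of_ne (mem_Ioi.1 hv).ne', mul_zero]
  · rw [Pi.single_eq_of_ne h, zero_mul]

theorem prod_single (r : Fin n) (m : ℕ) (f : Fin n → ℕ → ℂ) (hf : ∀ v, f v 0 = 1) :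
    ∏ v, f v ((Pi.single r m : MIdx n) v) = f r m := by
  rw [Fintype.prod_eq_single r fun v hv => by rw [Pi.single_eq_of_ne hv, hf], Pi.single_eq_same]

/-- Only row and column `r` contribute; by symmetry the column without its diagonal entry is the
product over pairs `u < v`. -/
theorem prod_prod_hook (r : Fin n) (f : Fin n → Fin n → ℂ) (hsymm : ∀ u v, f u v = f v u)
    (hone : ∀ u v, u ≠ r → v ≠ r → f u v = 1) :
    ∏ u, ∏ v, f u v = (∏ v, f r v) * ∏ u, ∏ v ∈ Ioi u, f u v := by
  let h : Fin n → Fin n → ℂ := fun u v => if u = r then f u v else 1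
  have h1 : ∏ u, ∏ v, h u v = ∏ v, f r v := by
    rw [Fintype.prod_eq_single r fun u hu => by simp [h, hu]]
    simp [h]
  have h2 : ∏ u, h u u = ∏ u, f u u := by
    refine prod_congr rfl fun u _ => ?_
    by_cases hu : u = r
    · simp [h, hu]
    · simp [h, hu, hone u u hu hu]
  have h3 : ∏ u, ∏ v ∈ Ioi u, h v u * h u v = ∏ u, ∏ v ∈ Ioi u, f u v := by
    refine prod_congr rfl fun u _ => prod_congr rfl fun v hv => ?_
    have huv : u ≠ v := (mem_Ioi.1 hv).ne
    by_cases hu : u = r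
    · have : v ≠ r := fun h => huv (hu.trans h.symm)
      simp [h, hu, this]
    · by_cases hv : v = r
      · simp [h, hu, hv, hsymm r u]
      · simp [h, hu, hv, hone u v hu hv]
  rw [prod_prod_eq_diag_mul] at h1
  rw [h2, h3] at h1
  rw [prod_prod_eq_diag_mul, ← h1, mul_assoc]
  congr 1
  rw [← prod_mul_distrib]
  refine prod_congr rfl fun u _ => ?_
  rw [← prod_mul_distrib]
  exact prod_congr rfl fun v _ => by rw [hsymm v u]

theorem thetaPoch_inv_mul_pow (hp : ‖p‖ < 1) (hq : q ≠ 0) {A : ℂ} (hA : A ≠ 0) (m : ℕ) :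
    thetaPoch q p (A * q ^ m)⁻¹ (m + 1)
      = thetaPoch q p A (m + 1) * ∏ i ∈ range (m + 1), -(A * q ^ i)⁻¹ := by
  simp only [thetaPoch]
  rw [← prod_range_reflect, ← prod_mul_distrib]
  refine prod_congr rfl fun i hi => ?_
  have hi : i ≤ m := Nat.lt_succ_iff.1 (mem_range.1 hi)
  have h : (A * q ^ m)⁻¹ * q ^ (m + 1 - 1 - i) = (A * q ^ i)⁻¹ := by
    have : q ^ m = q ^ (m - i) * q ^ i := by rw [← pow_add, Nat.sub_add_cancel hi]
    rw [Nat.add_sub_cancel, this]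
    field_simp
  rw [h, theta_inv hp (mul_ne_zero hA (pow_ne_zero i hq))]
  ring

theorem thetaPoch_ratio_ne_zero (hq : q ≠ 0)
    (hqx : ∀ (r s : Fin n) (m : ℤ), (r ≠ s ∨ m ≠ 0) → theta p (q ^ m * (x r / x s)) ≠ 0)
    (r s : Fin n) (k : ℕ) : thetaPoch q p (q * (x r / x s)) k ≠ 0 := by
  refine thetaPoch_ne_zero (fun m => ?_) k
  have := hqx r s (m + 1) (Or.inr (by omega))
  rwa [zpow_add_one₀ hq, zpow_natCast, show q ^ m * q * (x r / x s) = q * (x r / x s) * q ^ m by ring]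
    at this

theorem thetaPoch_shift_ratio_ne_zero (hq : q ≠ 0) (hx : ∀ r, x r ≠ 0)
    (hqx : ∀ (r s : Fin n) (m : ℤ), (r ≠ s ∨ m ≠ 0) → theta p (q ^ m * (x r / x s)) ≠ 0)
    (r v : Fin n) (m k : ℕ) :
    thetaPoch q p (q * (shiftVar q x (Pi.single r (m + 1)) v
      / shiftVar q x (Pi.single r (m + 1)) r)) k ≠ 0 := by
  refine thetaPoch_ne_zero (fun i => ?_) k
  have hr := hx r
  rcases eq_or_ne v r with rfl | h
  · have := hqx v v (i + 1) (Or.inr (by omega))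
    rw [div_self hr, mul_one, zpow_add_one₀ hq, zpow_natCast, mul_comm] at this
    rwa [div_self (by rw [shiftVar]; exact mul_ne_zero hr (pow_ne_zero _ hq)), mul_one]
  · have := hqx v r (i - m) (Or.inl h)
    rw [zpow_sub₀ hq, zpow_natCast, zpow_natCast] at this
    convert this using 2
    rw [shiftVar, shiftVar, Pi.single_eq_same, Pi.single_eq_of_ne h]
    field_simp
    ring

/-- The constant factor produced by `paramPart` and `polePart` at a node. -/
def nodeConst (q p : ℂ) (x : Fin n → ℂ) (β : ℂ) (r : Fin n) (m : ℕ) (M : MIdx n) : ℂ :=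
  (thetaPoch q p (β * x r * q ^ (m + 1)) (m + 1) * ∏ v, thetaPoch q p (β * x v) (m + 1))
    * (∏ v, (thetaPoch q p (q * (shiftVar q x (Pi.single r (m + 1)) v
          / shiftVar q x (Pi.single r (m + 1)) r)) (M v)
        / thetaPoch q p (q * (x v / x r)) ((Pi.single r (m + 1) : MIdx n) v + M v)))
    * ∏ v, ∏ s ∈ {r}ᶜ, (thetaPoch q p (q * (x v / x s)) ((Pi.single r (m + 1) : MIdx n) v))⁻¹

/-- At a node the parameter factors and the pole factors attached to `x_r` exchange roles: after the
shift, the former become poles in the new variables and the latter become the factors of the new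
parameter `q / x_r`. -/
theorem paramPart_mul_polePart_node (hq : q ≠ 0) (hx : ∀ r, x r ≠ 0)
    (hqx : ∀ (r s : Fin n) (m : ℤ), (r ≠ s ∨ m ≠ 0) → theta p (q ^ m * (x r / x s)) ≠ 0)
    (r : Fin n) (m : ℕ) {M k : MIdx n} (hk : k ≤ M) :
    paramPart q p x β (Pi.single r (m + 1) + M) (Pi.single r (m + 1) + k) (x r * q ^ m)⁻¹
        * polePart q p x β (Pi.single r (m + 1) + k)
      = nodeConst q p x β r m M
        * (paramPart q p (shiftVar q x (Pi.single r (m + 1))) (β * q ^ (m + 1)) M k (q / x r)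
          * polePart q p (shiftVar q x (Pi.single r (m + 1))) (β * q ^ (m + 1)) k) := by
  have hr := hx r
  have hne := thetaPoch_ratio_ne_zero hq hqx
  have hne' := thetaPoch_shift_ratio_ne_zero hq hx hqx r
  unfold nodeConst
  set j : MIdx n := Pi.single r (m + 1) with hj
  have hjr : j r = m + 1 := by rw [hj, Pi.single_eq_same]
  have hjs (s : Fin n) (hs : s ≠ r) : j s = 0 := by rw [hj, Pi.single_eq_of_ne hs]
  have hsj : size (j + k) = (m + 1) + size k := by rw [size_add, hj, size_single]
  have h1 : thetaPoch q p (β * q / (x r * q ^ m)⁻¹) (size (j + k))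
        * ∏ v, thetaPoch q p (β * x v) (size (j + k))
      = (thetaPoch q p (β * x r * q ^ (m + 1)) (m + 1) * ∏ v, thetaPoch q p (β * x v) (m + 1))
        * (thetaPoch q p (β * q ^ (m + 1) * q / (q / x r)) (size k)
          * ∏ v, thetaPoch q p (β * q ^ (m + 1) * shiftVar q x j v) (size k)) := by
    rw [hsj, show β * q / (x r * q ^ m)⁻¹ = β * x r * q ^ (m + 1) by rw [div_inv_eq_mul]; ring,
      show β * q ^ (m + 1) * q / (q / x r) = β * x r * q ^ (m + 1) by field_simp]
    simp only [thetaPoch_add _ (m + 1) (size k), prod_mul_distrib]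
    rw [Fintype.prod_eq_mul_prod_compl r fun v => thetaPoch q p (β * x v * q ^ (m + 1)) (size k),
      Fintype.prod_eq_mul_prod_compl r
        fun v => thetaPoch q p (β * q ^ (m + 1) * shiftVar q x j v) (size k)]
    have e1 : β * q ^ (m + 1) * shiftVar q x j r = β * x r * q ^ (m + 1) * q ^ (m + 1) := by
      rw [shiftVar, hjr]; ring
    have e2 : ∏ v ∈ {r}ᶜ, thetaPoch q p (β * q ^ (m + 1) * shiftVar q x j v) (size k)
        = ∏ v ∈ {r}ᶜ, thetaPoch q p (β * x v * q ^ (m + 1)) (size k) := by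
      refine prod_congr rfl fun v hv => ?_
      rw [shiftVar, hjs v (by simpa using hv)]
      congr 1; ring
    rw [e1, e2]
    ring
  have h2 (v : Fin n) : thetaPoch q p ((x r * q ^ m)⁻¹ * x v * q ^ (j + k) v) ((j + M) v - (j + k) v)
        / thetaPoch q p (q * (x v / x r)) ((j + k) v)
      = thetaPoch q p (q * (shiftVar q x j v / shiftVar q x j r)) (M v)
          / thetaPoch q p (q * (x v / x r)) (j v + M v)
        * (thetaPoch q p (q / x r * shiftVar q x j v * q ^ k v) (M v - k v)
          / thetaPoch q p (q * (shiftVar q x j v / shiftVar q x j r)) (k v)) := by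
    have a1 := thetaPoch_add (q := q) (p := p) (q * (shiftVar q x j v / shiftVar q x j r)) (k v)
      (M v - k v)
    have a2 := thetaPoch_add (q := q) (p := p) (q * (x v / x r)) (j v + k v) (M v - k v)
    rw [Nat.add_sub_cancel' (hk v)] at a1
    rw [add_assoc, Nat.add_sub_cancel' (hk v)] at a2
    have e1 : (x r * q ^ m)⁻¹ * x v * q ^ (j + k) v
        = q * (shiftVar q x j v / shiftVar q x j r) * q ^ k v := by
      rw [shiftVar, shiftVar, hjr, Pi.add_apply, pow_add, pow_add]
      field_simp
    have e2 : q / x r * shiftVar q x j v * q ^ k v = q * (x v / x r) * q ^ (j v + k v) := by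
      rw [shiftVar, pow_add]; ring
    rw [e1, e2, Pi.add_apply, Pi.add_apply, Nat.add_sub_add_left,
      div_mul_div_comm, div_eq_div_iff (hne _ _ _) (mul_ne_zero (hne _ _ _) (hne' _ _ _)), a1, a2]
    ring
  have h3 (v : Fin n) : ∏ s ∈ {r}ᶜ, thetaPoch q p (q * (x v / x s)) ((j + k) v)
      = (∏ s ∈ {r}ᶜ, thetaPoch q p (q * (x v / x s)) (j v))
        * ∏ s ∈ {r}ᶜ, thetaPoch q p (q * (shiftVar q x j v / shiftVar q x j s)) (k v) := by
    rw [← prod_mul_distrib]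
    refine prod_congr rfl fun s hs => ?_
    rw [Pi.add_apply, thetaPoch_add, shiftVar, shiftVar, hjs s (by simpa using hs)]
    congr 2
    ring
  have h4 (y : Fin n → ℂ) (B c : ℂ) (N l : MIdx n) : paramPart q p y B N l c * polePart q p y B l
      = (thetaPoch q p (B * q / c) (size l) * ∏ v, thetaPoch q p (B * y v) (size l))
        * (∏ v, (thetaPoch q p (c * y v * q ^ l v) (N v - l v)
          / thetaPoch q p (q * (y v / y r)) (l v)))
        * ∏ v, (∏ s ∈ {r}ᶜ, thetaPoch q p (q * (y v / y s)) (l v))⁻¹ := by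
    unfold paramPart polePart
    simp only [Fintype.prod_eq_mul_prod_compl r fun s => thetaPoch q p (q * (y _ / y s)) (l _),
      prod_mul_distrib, prod_div_distrib, prod_inv_distrib]
    ring
  rw [h4, h4, h1]
  simp only [h2, h3]
  simp only [mul_inv, prod_mul_distrib, prod_inv_distrib]
  ring

/-- The product side obeys the same reduction as the sum. The factors group into independent
families; the balancing condition enters only through `c₂` and `c₃`. -/
theorem nodeConst_mul_jacksonValue (hp : ‖p‖ < 1) (hq : q ≠ 0) (hx : ∀ r, x r ≠ 0) (hb : b ≠ 0)
    (hβ : β ≠ 0)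
    (hqx : ∀ (r s : Fin n) (m : ℤ), (r ≠ s ∨ m ≠ 0) → theta p (q ^ m * (x r / x s)) ≠ 0)
    (hβx : ∀ (r : Fin n) (m : ℕ), theta p (β * x r * q ^ m) ≠ 0)
    (hbxx : ∀ (r s : Fin n) (m : ℕ), r < s → theta p (b * x r * x s * q ^ m) ≠ 0)
    (r : Fin n) (m : ℕ) (M : MIdx n) {c₂ c₃ : ℂ} (hc₂ : c₂ ≠ 0) (hc₃ : c₃ ≠ 0)
    (hc : (x r * q ^ m)⁻¹ * c₂ * c₃ = b * β * q ^ 2) :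
    nodeConst q p x β r m M * thetaPoch q p (β * q / c₂) (m + 1)
        * thetaPoch q p (β * q / c₃) (m + 1) * shiftConst q p x b β (Pi.single r (m + 1))
        * jacksonValue q p (shiftVar q x (Pi.single r (m + 1))) b (q / x r) c₂ c₃ M
      = jacksonValue q p x b (x r * q ^ m)⁻¹ c₂ c₃ (Pi.single r (m + 1) + M) := by
  have hr := hx r
  have hne := thetaPoch_ratio_ne_zero hq hqx
  have hne' := thetaPoch_shift_ratio_ne_zero hq hx hqx r
  have hβne (v : Fin n) (k : ℕ) : thetaPoch q p (β * x v) k ≠ 0 := thetaPoch_ne_zero (hβx v) k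
  have hps := pairSum_single r (m + 1)
  have hss := size_single r (m + 1)
  unfold nodeConst shiftConst
  rw [hps, hss, prod_single r (m + 1) (fun v k => x v ^ k) fun v => pow_zero _]
  set j : MIdx n := Pi.single r (m + 1) with hj
  have hjr : j r = m + 1 := by rw [hj, Pi.single_eq_same]
  have hjs (s : Fin n) (hs : s ≠ r) : j s = 0 := by rw [hj, Pi.single_eq_of_ne hs]
  -- the factors containing `β`
  have hB : (thetaPoch q p (β * x r * q ^ (m + 1)) (m + 1) * ∏ v, thetaPoch q p (β * x v) (m + 1))
      * ∏ v, (thetaPoch q p (β * x v) (j v + (m + 1)))⁻¹ = 1 := by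
    rw [Fintype.prod_eq_mul_prod_compl r fun v => thetaPoch q p (β * x v) (m + 1),
      Fintype.prod_eq_mul_prod_compl r fun v => (thetaPoch q p (β * x v) (j v + (m + 1)))⁻¹]
    have : ∏ v ∈ {r}ᶜ, (thetaPoch q p (β * x v) (j v + (m + 1)))⁻¹
        = (∏ v ∈ {r}ᶜ, thetaPoch q p (β * x v) (m + 1))⁻¹ := by
      rw [← prod_inv_distrib]
      exact prod_congr rfl fun v hv => by rw [hjs v (by simpa using hv), zero_add]
    have h0 : ∏ v ∈ {r}ᶜ, thetaPoch q p (β * x v) (m + 1) ≠ 0 :=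
      prod_ne_zero_iff.2 fun v _ => hβne v _
    have h1 := hβne r (m + 1 + (m + 1))
    rw [thetaPoch_add] at h1
    have h2 := left_ne_zero_of_mul h1
    have h3 := right_ne_zero_of_mul h1
    have aux {A B C : ℂ} (hA : A ≠ 0) (hB : B ≠ 0) (hC : C ≠ 0) :
        B * (A * C) * ((A * B)⁻¹ * C⁻¹) = 1 := by field_simp
    rw [this, hjr, thetaPoch_add _ (m + 1) (m + 1)]
    exact aux h2 h3 h0
  -- the factors containing ratios of the variables
  have hP : (∏ v, (thetaPoch q p (q * (shiftVar q x j v / shiftVar q x j r)) (M v)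
        / thetaPoch q p (q * (x v / x r)) (j v + M v)))
      * (∏ v, ∏ s ∈ {r}ᶜ, (thetaPoch q p (q * (x v / x s)) (j v))⁻¹)
      * (∏ v, ∏ s, (thetaPoch q p (q * (shiftVar q x j v / shiftVar q x j s)) (M v))⁻¹)
      = ∏ v, ∏ s, (thetaPoch q p (q * (x v / x s)) (j v + M v))⁻¹ := by
    rw [← prod_mul_distrib, ← prod_mul_distrib]
    refine prod_congr rfl fun v _ => ?_
    rw [Fintype.prod_eq_mul_prod_compl r fun s =>
        (thetaPoch q p (q * (x v / x s)) (j v + M v))⁻¹,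
      Fintype.prod_eq_mul_prod_compl r fun s =>
        (thetaPoch q p (q * (shiftVar q x j v / shiftVar q x j s)) (M v))⁻¹]
    have : ∏ s ∈ {r}ᶜ, (thetaPoch q p (q * (x v / x s)) (j v + M v))⁻¹
        = (∏ s ∈ {r}ᶜ, (thetaPoch q p (q * (x v / x s)) (j v))⁻¹)
          * ∏ s ∈ {r}ᶜ, (thetaPoch q p (q * (shiftVar q x j v / shiftVar q x j s)) (M v))⁻¹ := by
      rw [← prod_mul_distrib]
      refine prod_congr rfl fun s hs => ?_
      rw [thetaPoch_add, mul_inv, shiftVar, shiftVar, hjs s (by simpa using hs)]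
      congr 3
      ring
    rw [this]
    have h1 := hne v r (j v + M v)
    have h2 := hne' v m (M v)
    have aux {A D B C : ℂ} (hA : A ≠ 0) (hD : D ≠ 0) :
        A / D * B * (A⁻¹ * C) = D⁻¹ * (B * C) := by field_simp
    exact aux h2 h1
  -- the factors containing products of the variables
  have hX : ((∏ v, ∏ s, thetaPoch q p (b * x v * x s) (j s + j v))
        / ∏ v, ∏ s ∈ Ioi v, thetaPoch q p (b * x v * x s) (j v + j s))
      * ((∏ v, thetaPoch q p (b * q * shiftVar q x j v / (q / x r)) (M v))
        * ∏ v, ∏ s, thetaPoch q p (b * shiftVar q x j v * shiftVar q x j s) (M v))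
      = (∏ v, thetaPoch q p (b * q * x v / (x r * q ^ m)⁻¹) (j v + M v))
        * ∏ v, ∏ s, thetaPoch q p (b * x v * x s) (j v + M v) := by
    have a1 : (∏ v, ∏ s, thetaPoch q p (b * x v * x s) (j s + j v))
        = (∏ v, thetaPoch q p (b * x v * x r) (m + 1 + j v))
          * ∏ v, ∏ s ∈ Ioi v, thetaPoch q p (b * x v * x s) (j v + j s) := by
      rw [prod_prod_hook r (fun v s => thetaPoch q p (b * x v * x s) (j s + j v))]
      · congr 1
        · exact prod_congr rfl fun v _ => by rw [hjr, add_comm, mul_right_comm]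
        · exact prod_congr rfl fun v _ => prod_congr rfl fun s _ => by rw [add_comm]
      · intro u v
        rw [add_comm, mul_right_comm]
      · intro u v hu hv
        rw [hjs u hu, hjs v hv, add_zero, thetaPoch_zero]
    have a2 : ∏ v, ∏ s ∈ Ioi v, thetaPoch q p (b * x v * x s) (j v + j s) ≠ 0 :=
      prod_ne_zero_iff.2 fun v _ => prod_ne_zero_iff.2 fun s hs =>
        thetaPoch_ne_zero (fun i => hbxx v s i (mem_Ioi.1 hs)) _
    have a3 : ∏ v, ∏ s, thetaPoch q p (b * x v * x s) (j v)
        = ∏ v, thetaPoch q p (b * x v * x r) (m + 1) := by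
      rw [hj, prod_single r (m + 1) (fun v k => ∏ s, thetaPoch q p (b * x v * x s) k) (by simp)]
      exact prod_congr rfl fun v _ => by rw [mul_right_comm]
    rw [a1, mul_div_cancel_right₀ _ a2]
    simp only [thetaPoch_add _ (j _) (M _)]
    have a4 : ∏ v, ∏ s, (thetaPoch q p (b * x v * x s) (j v)
          * thetaPoch q p (b * x v * x s * q ^ j v) (M v))
        = (∏ v, thetaPoch q p (b * x v * x r) (m + 1))
          * ∏ v, ∏ s, thetaPoch q p (b * x v * x s * q ^ j v) (M v) := by
      rw [← a3]; simp only [prod_mul_distrib]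
    rw [a4, ← prod_mul_distrib, ← prod_mul_distrib, ← prod_mul_distrib, ← prod_mul_distrib]
    refine prod_congr rfl fun v _ => ?_
    rw [Fintype.prod_eq_mul_prod_compl r fun s =>
        thetaPoch q p (b * x v * x s * q ^ j v) (M v),
      Fintype.prod_eq_mul_prod_compl r fun s =>
        thetaPoch q p (b * shiftVar q x j v * shiftVar q x j s) (M v)]
    have a5 : ∏ s ∈ {r}ᶜ, thetaPoch q p (b * shiftVar q x j v * shiftVar q x j s) (M v)
        = ∏ s ∈ {r}ᶜ, thetaPoch q p (b * x v * x s * q ^ j v) (M v) := by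
      refine prod_congr rfl fun s hs => ?_
      rw [shiftVar, shiftVar, hjs s (by simpa using hs)]
      congr 1; ring
    have a6 : b * q * shiftVar q x j v / (q / x r) = b * x v * x r * q ^ j v := by
      rw [shiftVar]; field_simp
    have a7 : b * q * x v / (x r * q ^ m)⁻¹ = b * x v * x r * q ^ (m + 1) := by
      rw [div_inv_eq_mul]; ring
    have a8 : b * shiftVar q x j v * shiftVar q x j r
        = b * x v * x r * q ^ (m + 1) * q ^ j v := by
      rw [shiftVar, shiftVar, hjr]; ring
    rw [a5, a6, a7, a8, thetaPoch_add]
    ring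
  -- the factors containing the two remaining parameters
  have hC (c : ℂ) : ∏ v, thetaPoch q p (b * q * x v / c) (j v + M v)
      = thetaPoch q p (b * q * x r / c) (m + 1)
        * ∏ v, thetaPoch q p (b * q * shiftVar q x j v / c) (M v) := by
    simp only [thetaPoch_add _ (j _) (M _), prod_mul_distrib]
    congr 1
    · exact prod_single r (m + 1) (fun v k => thetaPoch q p (b * q * x v / c) k) (by simp)
    · refine prod_congr rfl fun v _ => ?_
      rw [shiftVar]
      congr 1; ring
  have hR : thetaPoch q p (β * q / c₂) (m + 1) * thetaPoch q p (β * q / c₃) (m + 1)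
        * ((b / β) ^ (m + 1) * x r ^ (m + 1) * (q ^ 0)⁻¹)
      = thetaPoch q p (b * q * x r / c₂) (m + 1) * thetaPoch q p (b * q * x r / c₃) (m + 1) := by
    have hc' : c₂ * c₃ = b * β * q ^ 2 * (x r * q ^ m) := by
      rw [← hc]; field_simp
    have e1 : β * q / c₂ = (b * q * x r / c₃ * q ^ m)⁻¹ := by
      field_simp
      linear_combination -hc'
    have e2 : β * q / c₃ = (b * q * x r / c₂ * q ^ m)⁻¹ := by
      field_simp
      linear_combination -hc'
    have n1 : b * q * x r / c₂ ≠ 0 := by positivity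
    have n2 : b * q * x r / c₃ ≠ 0 := by positivity
    rw [e1, e2, thetaPoch_inv_mul_pow hp hq n1, thetaPoch_inv_mul_pow hp hq n2]
    -- Reversing one product pairs the index `i` with `m - i`; by balancing each pair, with its
    -- factor `(b / β) x_r`, contributes `1`.
    have e3 : (∏ i ∈ range (m + 1), -(b * q * x r / c₃ * q ^ i)⁻¹)
        * (∏ i ∈ range (m + 1), -(b * q * x r / c₂ * q ^ i)⁻¹)
        * ((b / β) ^ (m + 1) * x r ^ (m + 1)) = 1 := by
      rw [← prod_range_reflect, ← mul_pow, ← card_range (m + 1), ← prod_const, card_range,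
        ← prod_mul_distrib, ← prod_mul_distrib]
      refine prod_eq_one fun i hi => ?_
      have hi : i ≤ m := Nat.lt_succ_iff.1 (mem_range.1 hi)
      rw [Nat.add_sub_cancel]
      have : q ^ m = q ^ (m - i) * q ^ i := by rw [← pow_add, Nat.sub_add_cancel hi]
      rw [this] at hc'
      field_simp
      linear_combination hc'
    rw [pow_zero, inv_one, mul_one]
    linear_combination (thetaPoch q p (b * q * x r / c₂) (m + 1)
      * thetaPoch q p (b * q * x r / c₃) (m + 1)) * e3
  unfold jacksonValue
  have H := congrArg₂ (· * ·) (congrArg₂ (· * ·) hB hP) (congrArg₂ (· * ·) hX hR)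
  simp only [prod_mul_distrib, prod_div_distrib, prod_inv_distrib, Pi.add_apply, hC] at H ⊢
  linear_combination ((∏ v, thetaPoch q p (b * q * shiftVar q x j v / c₂) (M v))
    * ∏ v, thetaPoch q p (b * q * shiftVar q x j v / c₃) (M v)) * H

end NodeReduction

/-! ### The Jackson sum at the special values of `c₁`. -/

section JacksonSum

variable {n : ℕ} {q p : ℂ} {x : Fin n → ℂ} {b β c₁ c₂ c₃ : ℂ}

/-- None of the denominators in the `D_n` elliptic Jackson summation vanishes. -/
structure Admissible (q p : ℂ) (x : Fin n → ℂ) (b β : ℂ) : Prop where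
  var_ne : ∀ r, x r ≠ 0
  b_ne : b ≠ 0
  beta_ne : β ≠ 0
  ratio : ∀ (r s : Fin n) (m : ℤ), (r ≠ s ∨ m ≠ 0) → theta p (q ^ m * (x r / x s)) ≠ 0
  beta : ∀ (r : Fin n) (m : ℕ), theta p (β * x r * q ^ m) ≠ 0
  prod : ∀ (r s : Fin n) (m : ℕ), r < s → theta p (b * x r * x s * q ^ m) ≠ 0

/-- Allows the induction hypothesis, stated for all admissible parameters, to be used at shifted
ones. -/
theorem Admissible.shift (hq : q ≠ 0) (h : Admissible q p x b β) (j : MIdx n) :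
    Admissible q p (shiftVar q x j) b (β * q ^ size j) where
  var_ne r := mul_ne_zero (h.var_ne r) (pow_ne_zero _ hq)
  b_ne := h.b_ne
  beta_ne := mul_ne_zero h.beta_ne (pow_ne_zero _ hq)
  ratio r s m hrs := by
    have hs := h.var_ne s
    have := h.ratio r s (m + j r - j s) (by
      rcases eq_or_ne r s with rfl | hne
      · exact Or.inr (by have := hrs.resolve_left (by simp); omega)
      · exact Or.inl hne)
    convert this using 2
    rw [shiftVar, shiftVar, zpow_sub₀ hq, zpow_add₀ hq, zpow_natCast, zpow_natCast]
    field_simp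
  beta r m := by
    convert h.beta r (size j + j r + m) using 2
    rw [shiftVar, pow_add, pow_add]; ring
  prod r s m hrs := by
    convert h.prod r s (j r + j s + m) hrs using 2
    rw [shiftVar, shiftVar, pow_add, pow_add]; ring

/-- The `D_n` elliptic Jackson summation for the upper limits `N`. -/
def HasJacksonSum (q p : ℂ) (N : MIdx n) : Prop :=
  ∀ (x : Fin n → ℂ) (b β c₁ c₂ c₃ : ℂ), Admissible q p x b β → c₁ ≠ 0 → c₂ ≠ 0 → c₃ ≠ 0 →
    c₁ * c₂ * c₃ = b * β * q ^ 2 →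
    ∑ k ∈ Iic N, jacksonTerm q p x b β c₁ c₂ c₃ N k = jacksonValue q p x b c₁ c₂ c₃ N

theorem sum_Iic_add (j M : MIdx n) (f : MIdx n → ℂ) (hf : ∀ k ≤ j + M, ¬ j ≤ k → f k = 0) :
    ∑ k ∈ Iic (j + M), f k = ∑ k ∈ Iic M, f (j + k) := by
  refine Eq.trans ?_ (sum_map (Iic M) (addLeftEmbedding j) f)
  refine (sum_subset (fun k hk => ?_) fun k hk hk' => ?_).symm
  · obtain ⟨l, hl, rfl⟩ := mem_map.1 hk
    exact mem_Iic.2 (add_le_add_right (mem_Iic.1 hl) j)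
  · refine hf k (mem_Iic.1 hk) fun h => hk' (mem_map.2 ⟨k - j, ?_, add_tsub_cancel_of_le h⟩)
    exact mem_Iic.2 (tsub_le_iff_left.2 (mem_Iic.1 hk))

/-- Terms with `k_r ≤ m` contain `θ(1) = 0`. The others, reindexed, form a balanced Jackson sum with
upper limits `M`, in which `c₁` is replaced by `q / x_r` and `β` by `β q^{m+1}`. -/
theorem sum_jacksonTerm_node (hp : ‖p‖ < 1) (hq : q ≠ 0) (h : Admissible q p x b β)
    (r : Fin n) (m : ℕ) (M : MIdx n) (ih : HasJacksonSum q p M) (hc₂ : c₂ ≠ 0) (hc₃ : c₃ ≠ 0)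
    (hc : (x r * q ^ m)⁻¹ * c₂ * c₃ = b * β * q ^ 2) :
    ∑ k ∈ Iic (Pi.single r (m + 1) + M),
        jacksonTerm q p x b β (x r * q ^ m)⁻¹ c₂ c₃ (Pi.single r (m + 1) + M) k
      = jacksonValue q p x b (x r * q ^ m)⁻¹ c₂ c₃ (Pi.single r (m + 1) + M) := by
  have hr := h.var_ne r
  rw [sum_Iic_add, ← nodeConst_mul_jacksonValue hp hq h.var_ne h.b_ne h.beta_ne h.ratio h.beta h.prod
    r m M hc₂ hc₃ hc, ← ih _ _ (β * q ^ (m + 1)) _ _ _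
      (by simpa only [size_single] using h.shift hq (Pi.single r (m + 1)))
      (div_ne_zero hq hr) hc₂ hc₃ (by
        have : c₂ * c₃ = b * β * q ^ 2 * (x r * q ^ m) := by rw [← hc]; field_simp
        rw [mul_assoc, this]
        field_simp
        ring), mul_sum]
  · refine sum_congr rfl fun k hk => ?_
    have e1 := paramPart_mul_polePart_node (β := β) hq h.var_ne h.ratio r m (mem_Iic.1 hk)
    simp only [jacksonTerm, paramPart_shift _ M k c₂, paramPart_shift _ M k c₃,
      shiftPart_shift hq h.var_ne, size_single]
    linear_combination (thetaPoch q p (β * q / c₂) (m + 1)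
      * paramPart q p (shiftVar q x (Pi.single r (m + 1))) (β * q ^ (m + 1)) M k c₂
      * (thetaPoch q p (β * q / c₃) (m + 1)
      * paramPart q p (shiftVar q x (Pi.single r (m + 1))) (β * q ^ (m + 1)) M k c₃)
      * (shiftConst q p x b β (Pi.single r (m + 1))
      * shiftPart q p (shiftVar q x (Pi.single r (m + 1))) b (β * q ^ (m + 1)) M k)) * e1
  · intro k hk hjk
    have hkr : k r ≤ m := by
      by_contra hlt
      refine hjk fun s => ?_
      rcases eq_or_ne s r with rfl | hs
      · rw [Pi.single_eq_same]; exact Nat.lt_of_not_le hlt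
      · rw [Pi.single_eq_of_ne hs]; exact Nat.zero_le _
    have : paramPart q p x β (Pi.single r (m + 1) + M) k (x r * q ^ m)⁻¹ = 0 := by
      refine mul_eq_zero_of_right _ (prod_eq_zero (mem_univ r) ?_)
      refine thetaPoch_eq_zero hp (i := m - k r) ?_ ?_
      · rw [Pi.add_apply, Pi.single_eq_same]; omega
      · rw [mul_assoc, ← pow_add, Nat.add_sub_cancel' hkr]
        field_simp
    rw [jacksonTerm, this]
    ring

/-- The factor `(1; q, p)_{|k|}` kills every term with `k ≠ 0`. This is the one interpolation point
beyond the `|N|` recursive ones. -/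
theorem sum_jacksonTerm_beta (hp : ‖p‖ < 1) (hq : q ≠ 0) (h : Admissible q p x b β) (N : MIdx n)
    (hc₂ : c₂ ≠ 0) (hc₃ : c₃ ≠ 0) (hc : β * q * c₂ * c₃ = b * β * q ^ 2) :
    ∑ k ∈ Iic N, jacksonTerm q p x b β (β * q) c₂ c₃ N k
      = jacksonValue q p x b (β * q) c₂ c₃ N := by
  have hβ := h.beta_ne
  have hc' : c₂ * c₃ = b * q := by
    have : β * q * (c₂ * c₃) = β * q * (b * q) := by linear_combination hc
    exact mul_left_cancel₀ (mul_ne_zero hβ hq) this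
  rw [sum_eq_single 0]
  · have hs : size (0 : MIdx n) = 0 := by simp [size]
    have hps : pairSum (0 : MIdx n) = 0 := by simp [pairSum]
    have e1 (r : Fin n) : β * q * x r = β * x r * q := by ring
    have e2 (r : Fin n) : b * q * x r / (β * q) = b * x r / β := by field_simp
    have e3 (r : Fin n) : b * q * x r / c₂ = c₃ * x r := by
      field_simp; linear_combination -hc' * x r
    have e4 (r : Fin n) : b * q * x r / c₃ = c₂ * x r := by
      field_simp; linear_combination -hc' * x r
    simp only [jacksonTerm, jacksonValue, paramPart, polePart, shiftPart, hs, hps, e2, e3, e4]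
    simp only [Pi.zero_apply, thetaPoch_zero, pow_zero, mul_one, Nat.sub_zero, add_zero, one_mul,
      div_one, prod_const_one, inv_one, Nat.cast_zero, sub_zero, zpow_one]
    rw [prod_comm (f := fun r s => thetaPoch q p (b * x r * x s) (N s))]
    simp only [← prod_mul_distrib, ← prod_div_distrib]
    refine prod_congr rfl fun r _ => ?_
    have h0 := h.beta r 0
    have h1 : thetaPoch q p (β * x r) (N r + 1) ≠ 0 := thetaPoch_ne_zero (h.beta r) _
    rw [thetaPoch_succ'] at h1 ⊢
    have h2 := right_ne_zero_of_mul h1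
    rw [pow_zero, mul_one] at h0
    have e5 : ∏ s, (thetaPoch q p (b * x s * x r) (N r) / thetaPoch q p (q * (x r / x s)) (N r))
        = ∏ s, (thetaPoch q p (b * x r * x s) (N r) / thetaPoch q p (q * (x r / x s)) (N r)) :=
      prod_congr rfl fun s _ => by rw [mul_right_comm]
    have aux {A B C D E P : ℂ} (hA : A ≠ 0) (hB : B ≠ 0) :
        B * C * D * (A / (A * B) * E * P) = E * D * C * P := by
      field_simp
    rw [e1, e5]
    exact aux h0 h2
  · intro k _ hk
    have hs : 0 < size k := by
      by_contra hs
      refine hk (funext fun r => ?_)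
      have := sum_eq_zero_iff.1 (Nat.eq_zero_of_not_pos hs)
      exact this r (mem_univ r)
    have : paramPart q p x β N k (β * q) = 0 := by
      refine mul_eq_zero_of_left (thetaPoch_eq_zero hp hs ?_) _
      rw [pow_zero, mul_one, div_self (mul_ne_zero hβ hq)]
    rw [jacksonTerm, this]
    ring
  · simp

end JacksonSum

/-! ### Both sides of the summation as forms of degree `|N|`. -/

section Forms

variable {n : ℕ} {q p : ℂ} {S : Finset ℂ} {X w : ℂ → ℂ}

theorem IsForm.congr {L : ℕ} {f g : ℂ → ℂ} (hf : IsForm S X w L f) (h : ∀ c ∈ S, f c = g c) :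
    IsForm S X w L g := by
  obtain ⟨P, hP, hPf⟩ := hf
  exact ⟨P, hP, fun c hc => by rw [← h c hc, hPf c hc]⟩

variable {C : ℂ}

theorem isForm_thetaPoch_mul (hq : q ≠ 0)
    (hX : ∀ u, u ≠ 0 → ∃ α β, ∀ c ∈ S,
      theta p (c * u) * theta p (C * u / c) = w c * (α * X c + β)) {u : ℂ} (hu : u ≠ 0) (k : ℕ) :
    IsForm S X w k fun c => thetaPoch q p (c * u) k * thetaPoch q p (C * u / c) k := by
  have h := isForm_prod (S := S) (X := X) (w := w) (range k) (fun _ => 1)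
    (fun j c => theta p (c * (u * q ^ j)) * theta p (C * (u * q ^ j) / c)) fun j _ => by
      obtain ⟨α, β, hαβ⟩ := hX (u * q ^ j) (mul_ne_zero hu (pow_ne_zero j hq))
      refine ⟨Polynomial.C α * Polynomial.X + Polynomial.C β, Polynomial.natDegree_linear_le,
        fun c hc => ?_⟩
      simp [hαβ c hc]
  rw [sum_const, card_range, smul_eq_mul, mul_one] at h
  refine h.congr fun c _ => ?_
  rw [prod_mul_distrib, thetaPoch, thetaPoch]
  congr 1
  · exact prod_congr rfl fun j _ => by rw [mul_assoc]
  · exact prod_congr rfl fun j _ => by congr 1; ring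

theorem isForm_paramPart_mul (hq : q ≠ 0) (hC : C ≠ 0) (hS : ∀ c ∈ S, c ≠ 0)
    (hX : ∀ u, u ≠ 0 → ∃ α β, ∀ c ∈ S,
      theta p (c * u) * theta p (C * u / c) = w c * (α * X c + β))
    {x : Fin n → ℂ} (hx : ∀ r, x r ≠ 0) {β : ℂ} (hβ : β ≠ 0) {N k : MIdx n} (hk : k ≤ N) :
    IsForm S X w (size N) fun c => paramPart q p x β N k c * paramPart q p x β N k (C / c) := by
  -- The choice `u = βq / C` turns `cu` and `Cu/c` into `βq/(C/c)` and `βq/c`. The total degree `|k|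
  -- + ∑ (N_r - k_r) = |N|` does not depend on `k`.
  have h1 := isForm_thetaPoch_mul (p := p) hq hX
    (div_ne_zero (mul_ne_zero hβ hq) hC) (size k)
  have h2 := isForm_prod (S := S) (X := X) (w := w) univ (fun r => N r - k r) _ fun r _ =>
    isForm_thetaPoch_mul (p := p) hq hX (mul_ne_zero (hx r) (pow_ne_zero (k r) hq)) (N r - k r)
  have h3 : size k + ∑ r, (N r - k r) = size N := by
    rw [size, ← sum_add_distrib]
    exact sum_congr rfl fun r _ => Nat.add_sub_cancel' (hk r)
  rw [← h3]
  refine (h1.mul h2).congr fun c hc => ?_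
  have hc0 := hS c hc
  simp only [paramPart, prod_mul_distrib]
  rw [show c * (β * q / C) = β * q / (C / c) by field_simp,
    show C * (β * q / C) / c = β * q / c by field_simp]
  simp only [← mul_assoc, mul_div_right_comm]
  ring

theorem isForm_jacksonValue (hq : q ≠ 0) (hC : C ≠ 0) (hS : ∀ c ∈ S, c ≠ 0)
    (hX : ∀ u, u ≠ 0 → ∃ α β, ∀ c ∈ S,
      theta p (c * u) * theta p (C * u / c) = w c * (α * X c + β))
    {x : Fin n → ℂ} (hx : ∀ r, x r ≠ 0) {b : ℂ} (hb : b ≠ 0) (c₃ : ℂ) (N : MIdx n) :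
    IsForm S X w (size N) fun c => jacksonValue q p x b c (C / c) c₃ N := by
  have h := isForm_prod (S := S) (X := X) (w := w) univ N _ fun r _ =>
    isForm_thetaPoch_mul (p := p) hq hX
      (div_ne_zero (mul_ne_zero (mul_ne_zero hb hq) (hx r)) hC) (N r)
  refine (h.const_mul (∏ r, (thetaPoch q p (b * q * x r / c₃) (N r)
    * ∏ s, (thetaPoch q p (b * x r * x s) (N r) / thetaPoch q p (q * (x r / x s)) (N r))))).congr
    fun c hc => ?_
  have hc0 := hS c hc
  rw [jacksonValue, ← prod_mul_distrib]
  refine prod_congr rfl fun r _ => ?_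
  rw [show c * (b * q * x r / C) = b * q * x r / (C / c) by field_simp,
    show C * (b * q * x r / C) / c = b * q * x r / c by field_simp]
  ring

end Forms

/-! ### Proof of the Jackson summation by induction and continuity. -/

section JacksonInduction

open Topology

variable {n : ℕ} {q p : ℂ} {x : Fin n → ℂ} {b β c₁ c₂ c₃ : ℂ}

/-- Interpolation in `c₁` with `c₁ c₂` and `c₃` fixed. Two nodes `c, d` can share a coordinate only
if `θ(c/d)` or `θ(cd/C)` vanishes; admissibility excludes the first, `hg₁` and `hg₂` the second. -/
theorem sum_jacksonTerm_of_generic (hp : ‖p‖ < 1) (hq : q ≠ 0) (N : MIdx n)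
    (ih : ∀ M : MIdx n, size M < size N → HasJacksonSum q p M) (h : Admissible q p x b β)
    (hc₁ : c₁ ≠ 0) (hc₂ : c₂ ≠ 0) (hc₃ : c₃ ≠ 0) (hc : c₁ * c₂ * c₃ = b * β * q ^ 2)
    (hg₁ : ∀ (r : Fin n) (i : ℕ), theta p (β * q * (x r * q ^ i)⁻¹ / (c₁ * c₂)) ≠ 0)
    (hg₂ : ∀ (r s : Fin n) (i l : ℕ),
      theta p ((x r * q ^ i)⁻¹ * (x s * q ^ l)⁻¹ / (c₁ * c₂)) ≠ 0) :
    ∑ k ∈ Iic N, jacksonTerm q p x b β c₁ c₂ c₃ N k = jacksonValue q p x b c₁ c₂ c₃ N := by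
  classical
  have hC : c₁ * c₂ ≠ 0 := mul_ne_zero hc₁ hc₂
  have hβq : β * q ≠ 0 := mul_ne_zero h.beta_ne hq
  have hxq (r : Fin n) (i : ℕ) : x r * q ^ i ≠ 0 := mul_ne_zero (h.var_ne r) (pow_ne_zero i hq)
  -- The `|N| + 1` nodes: `none` is `βq`, and the others are `(x_r q^i)⁻¹` with `0 ≤ i < N_r`.
  let d : Option (Σ r, Fin (N r)) → ℂ := fun o =>
    o.elim (β * q) fun z => (x z.1 * q ^ (z.2 : ℕ))⁻¹
  let S : Finset ℂ := insert c₁ (univ.image d)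
  have hd (o) : d o ∈ S := mem_insert_of_mem (mem_image_of_mem d (mem_univ o))
  have hS : ∀ c ∈ S, c ≠ 0 := by
    intro c hcS
    rcases mem_insert.1 hcS with rfl | hcS
    · exact hc₁
    · obtain ⟨_ | z, -, rfl⟩ := mem_image.1 hcS
      · exact hβq
      · exact inv_ne_zero (hxq _ _)
  obtain ⟨X, w, hw, hX, hinj⟩ := exists_affine_coordinate hp hC S hS
  have hf : IsForm S X w (size N) fun c =>
      ∑ k ∈ Iic N, jacksonTerm q p x b β c (c₁ * c₂ / c) c₃ N k
        + -1 * jacksonValue q p x b c (c₁ * c₂ / c) c₃ N := by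
    refine (isForm_sum _ _ fun k hk => ?_).add
      ((isForm_jacksonValue hq hC hS hX h.var_ne h.b_ne c₃ N).const_mul (-1))
    refine ((isForm_paramPart_mul hq hC hS hX h.var_ne h.beta_ne (mem_Iic.1 hk)).const_mul
      (paramPart q p x β N k c₃ * shiftPart q p x b β N k * polePart q p x β k)).congr
      fun c _ => ?_
    rw [jacksonTerm]; ring
  have hns (z : Σ r, Fin (N r)) : X (d none) ≠ X (d (some z)) := fun hXz => by
    have h1 := hinj _ (hd none) _ (hd (some z)) hXz
    refine mul_ne_zero ?_ (hg₁ z.1 z.2) h1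
    convert h.beta z.1 (1 + z.2) using 2
    simp only [d, Option.elim]
    rw [div_inv_eq_mul, pow_add]; ring
  have hXinj : Function.Injective (X ∘ d) := by
    rintro (_ | z) (_ | y) hzy
    · rfl
    · exact absurd hzy (hns y)
    · exact absurd hzy.symm (hns z)
    · have h1 := hinj _ (hd (some z)) _ (hd (some y)) hzy
      by_contra hne
      refine mul_ne_zero ?_ (hg₂ z.1 y.1 z.2 y.2) h1
      obtain ⟨r, i⟩ := z
      obtain ⟨s, l⟩ := y
      have hrs : s ≠ r ∨ ((l : ℤ) - i) ≠ 0 := by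
        by_contra hcon
        push Not at hcon
        obtain ⟨rfl, hil⟩ := hcon
        have : i = l := Fin.ext (by omega)
        exact hne (by rw [this])
      have hr := h.var_ne r
      convert h.ratio s r _ hrs using 2
      simp only [d, Option.elim]
      rw [zpow_sub₀ hq, zpow_natCast, zpow_natCast]
      field_simp
  have hzero (o) : ∑ k ∈ Iic N, jacksonTerm q p x b β (d o) (c₁ * c₂ / d o) c₃ N k
        + -1 * jacksonValue q p x b (d o) (c₁ * c₂ / d o) c₃ N = 0 := by
    have hdo := hS _ (hd o)
    have hprod : d o * (c₁ * c₂ / d o) * c₃ = b * β * q ^ 2 := by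
      rw [mul_div_cancel₀ _ hdo, hc]
    rw [neg_one_mul, ← sub_eq_add_neg, sub_eq_zero]
    rcases o with _ | ⟨r, i⟩
    · exact sum_jacksonTerm_beta hp hq h N (div_ne_zero hC hdo) hc₃ (by
        rw [← hprod]; rfl)
    · have hle : Pi.single r ((i : ℕ) + 1) ≤ N := by
        intro s
        rcases eq_or_ne s r with rfl | hs
        · rw [Pi.single_eq_same]; exact i.2
        · rw [Pi.single_eq_of_ne hs]; exact Nat.zero_le _
      obtain ⟨M, hM⟩ := exists_add_of_le hle
      have hsize : size M < size N := by
        rw [hM, size_add, size_single]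
        omega
      have key := sum_jacksonTerm_node hp hq h r i M (ih M hsize) (div_ne_zero hC hdo) hc₃ hprod
      rw [← hM] at key
      exact key
  have := hf.eq_zero hw d hd hXinj (by simp [size]) hzero (mem_insert_self _ _)
  rw [mul_div_cancel_left₀ _ hc₁, neg_one_mul, ← sub_eq_add_neg, sub_eq_zero] at this
  exact this

theorem continuousAt_thetaPoch_comp (hp : ‖p‖ < 1) (hq : q ≠ 0) {g : ℂ → ℂ} {t : ℂ}
    (hg : ContinuousAt g t) (h : g t ≠ 0) (k : ℕ) :
    ContinuousAt (fun s => thetaPoch q p (g s) k) t :=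
  tendsto_finsetProd _ fun j _ =>
    ((continuousAt_theta hp (mul_ne_zero h (pow_ne_zero j hq))).comp (f := fun s => g s * q ^ j)
      (hg.mul continuousAt_const)).tendsto

theorem continuousAt_paramPart (hp : ‖p‖ < 1) (hq : q ≠ 0) (hx : ∀ r, x r ≠ 0) (hβ : β ≠ 0)
    {g : ℂ → ℂ} {t : ℂ} (hg : ContinuousAt g t) (h : g t ≠ 0) (N k : MIdx n) :
    ContinuousAt (fun s => paramPart q p x β N k (g s)) t :=
  (continuousAt_thetaPoch_comp hp hq (continuousAt_const.div hg h)
    (div_ne_zero (mul_ne_zero hβ hq) h) _).mul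
  (tendsto_finsetProd _ fun r _ => (continuousAt_thetaPoch_comp hp hq
    ((hg.mul continuousAt_const).mul continuousAt_const)
    (mul_ne_zero (mul_ne_zero h (hx r)) (pow_ne_zero _ hq)) _).tendsto)

theorem continuousAt_jacksonTerm (hp : ‖p‖ < 1) (hq : q ≠ 0) (h : Admissible q p x b β)
    {g₂ g₃ : ℂ → ℂ} {t : ℂ} (hg₂ : ContinuousAt g₂ t) (hg₃ : ContinuousAt g₃ t)
    (h₂ : g₂ t ≠ 0) (h₃ : g₃ t ≠ 0) (N k : MIdx n) :
    ContinuousAt (fun s => jacksonTerm q p x b β c₁ (g₂ s) (g₃ s) N k) t :=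
  (((continuousAt_const.mul (continuousAt_paramPart hp hq h.var_ne h.beta_ne hg₂ h₂ N k)).mul
    (continuousAt_paramPart hp hq h.var_ne h.beta_ne hg₃ h₃ N k)).mul
    continuousAt_const).mul continuousAt_const

theorem continuousAt_jacksonValue (hp : ‖p‖ < 1) (hq : q ≠ 0) (h : Admissible q p x b β)
    {g₂ g₃ : ℂ → ℂ} {t : ℂ} (hg₂ : ContinuousAt g₂ t) (hg₃ : ContinuousAt g₃ t)
    (h₂ : g₂ t ≠ 0) (h₃ : g₃ t ≠ 0) (N : MIdx n) :
    ContinuousAt (fun s => jacksonValue q p x b c₁ (g₂ s) (g₃ s) N) t := by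
  have hne (r : Fin n) : b * q * x r ≠ 0 := mul_ne_zero (mul_ne_zero h.b_ne hq) (h.var_ne r)
  exact tendsto_finsetProd _ fun r _ => (((continuousAt_const.mul
    (continuousAt_thetaPoch_comp hp hq (continuousAt_const.div hg₂ h₂)
      (div_ne_zero (hne r) h₂) _)).mul
    (continuousAt_thetaPoch_comp hp hq (continuousAt_const.div hg₃ h₃)
      (div_ne_zero (hne r) h₃) _)).mul continuousAt_const).tendsto

/-- The `D_n` elliptic Jackson summation. -/
theorem hasJacksonSum (hp : ‖p‖ < 1) (hq : q ≠ 0) (N : MIdx n) : HasJacksonSum q p N := by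
  induction hN : size N using Nat.strong_induction_on generalizing N with
  | _ L ih =>
    have ih' (M : MIdx n) (hM : size M < size N) : HasJacksonSum q p M := ih _ (hN ▸ hM) M rfl
    intro x b β c₁ c₂ c₃ h hc₁ hc₂ hc₃ hc
    have hb := h.b_ne
    have hβ := h.beta_ne
    have hxq (r : Fin n) (i : ℕ) : (x r * q ^ i)⁻¹ ≠ 0 :=
      inv_ne_zero (mul_ne_zero (h.var_ne r) (pow_ne_zero i hq))
    have hD : β * q ^ 2 ≠ 0 := mul_ne_zero hβ (pow_ne_zero 2 hq)
    -- A deformation that keeps `c₁` and the balancing condition, makes `c₁ c₂ = β q² t` vary, and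
    -- returns to the given parameters at `t = b / c₃`. Genericity fails only for countably many
    -- `t`.
    let F : ℂ → ℂ := fun t =>
      ∑ k ∈ Iic N, jacksonTerm q p x b β c₁ (β * q ^ 2 * t / c₁) (b / t) N k
        - jacksonValue q p x b c₁ (β * q ^ 2 * t / c₁) (b / t) N
    let Z : Set ℂ := {0} ∪
      ((⋃ (r : Fin n) (i : ℕ), {t | theta p (β * q * (x r * q ^ i)⁻¹ / (β * q ^ 2) / t) = 0})
      ∪ ⋃ (r : Fin n) (s : Fin n) (i : ℕ) (l : ℕ),
        {t | theta p ((x r * q ^ i)⁻¹ * (x s * q ^ l)⁻¹ / (β * q ^ 2) / t) = 0})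
    have hZ : Z.Countable := by
      refine .union (Set.countable_singleton 0) (.union ?_ ?_)
      · exact Set.countable_iUnion fun r => Set.countable_iUnion fun i =>
          countable_theta_div_zeros hp (div_ne_zero (mul_ne_zero (mul_ne_zero hβ hq) (hxq r i)) hD)
      · exact Set.countable_iUnion fun r => Set.countable_iUnion fun s =>
          Set.countable_iUnion fun i => Set.countable_iUnion fun l =>
            countable_theta_div_zeros hp (div_ne_zero (mul_ne_zero (hxq r i) (hxq s l)) hD)
    have hFZ (t : ℂ) (ht : t ∈ Zᶜ) : F t = 0 := by
      simp only [Z, Set.mem_compl_iff, Set.mem_union, Set.mem_singleton_iff, Set.mem_iUnion,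
        Set.mem_ofPred_eq, not_or, not_exists] at ht
      obtain ⟨ht0, ht1, ht2⟩ := ht
      have e : c₁ * (β * q ^ 2 * t / c₁) = β * q ^ 2 * t := mul_div_cancel₀ _ hc₁
      refine sub_eq_zero.2 (sum_jacksonTerm_of_generic hp hq N ih' h hc₁
        (div_ne_zero (mul_ne_zero hD ht0) hc₁) (div_ne_zero hb ht0) ?_ (fun r i => ?_)
        fun r s i l => ?_)
      · rw [e]; field_simp
      · rw [e, ← div_div]; exact ht1 r i
      · rw [e, ← div_div]; exact ht2 r s i l
    have ht : b / c₃ ≠ 0 := div_ne_zero hb hc₃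
    have e2 : β * q ^ 2 * (b / c₃) / c₁ = c₂ := by
      field_simp
      linear_combination -hc
    have e3 : b / (b / c₃) = c₃ := div_div_cancel₀ hb
    have hF : ContinuousAt F (b / c₃) := by
      have g2 : ContinuousAt (fun t : ℂ => β * q ^ 2 * t / c₁) (b / c₃) := by fun_prop
      have g3 : ContinuousAt (fun t : ℂ => b / t) (b / c₃) :=
        continuousAt_const.div continuousAt_id ht
      have h2 : β * q ^ 2 * (b / c₃) / c₁ ≠ 0 := by rwa [e2]
      have h3 : b / (b / c₃) ≠ 0 := by rwa [e3]
      exact ContinuousAt.sub (tendsto_finsetSum _ fun k _ =>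
        (continuousAt_jacksonTerm hp hq h g2 g3 h2 h3 N k).tendsto)
        (continuousAt_jacksonValue hp hq h g2 g3 h2 h3 N)
    have hF0 : F (b / c₃) = 0 := by
      by_contra hne
      have h1 := hF.eventually_ne hne
      have h2 := mem_closure_iff_frequently.1 (hZ.dense_compl ℂ (b / c₃))
      obtain ⟨t, ht1, ht2⟩ := (h2.and_eventually h1).exists
      exact ht2 (hFZ t ht1)
    simp only [F, e2, e3] at hF0
    exact sub_eq_zero.1 hF0

end JacksonInduction

/-! ### Matching the Bailey matrices with the Jackson sum. -/

section BaileyLemma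

variable {n : ℕ} {q p : ℂ} {x : Fin n → ℂ} {a b ρ₁ ρ₂ : ℂ}

theorem ellFac_natCast_sub {A : ℂ} {N k : ℕ} (h : k ≤ N) :
    ellFac q p A ((N : ℤ) - k) = thetaPoch q p A (N - k) := by
  rw [← Nat.cast_sub h, ellFac_natCast]

theorem ellFac_natCast_add (A : ℂ) (N k : ℕ) :
    ellFac q p A ((N : ℤ) + k) = thetaPoch q p A (N + k) := by
  rw [← Nat.cast_add, ellFac_natCast]

/-- For negative `i` the step cancels a factor of a denominator, hence the condition there only. -/
theorem ellFac_add_one {A : ℂ} (i : ℤ) (h : i < 0 → theta p (A * q ^ i) ≠ 0) :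
    ellFac q p A (i + 1) = ellFac q p A i * theta p (A * q ^ i) := by
  rcases i with m | m
  · change (∏ j ∈ range (m + 1), theta p (A * q ^ j)) = _
    rw [prod_range_succ]
    simp [ellFac]
  · have h0 := h (Int.negSucc_lt_zero m)
    have e : Int.negSucc m + 1 = -(m : ℤ) := by omega
    have e' : Int.negSucc m = -((m : ℤ) + 1) := by omega
    rw [e'] at h0
    rcases m with _ | m
    · rw [e]
      simp only [Nat.cast_zero, zero_add, zpow_neg_one] at h0
      simp [ellFac, inv_mul_cancel₀ h0]
    · rw [e, show (-((m + 1 : ℕ) : ℤ)) = Int.negSucc m by omega]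
      change (∏ j ∈ range (m + 1), theta p (A * q ^ (-((j : ℤ) + 1))))⁻¹
        = (∏ j ∈ range (m + 1 + 1), theta p (A * q ^ (-((j : ℤ) + 1))))⁻¹ * _
      rw [prod_range_succ _ (m + 1), e', mul_inv, mul_assoc, inv_mul_cancel₀ h0, mul_one]

theorem ellFac_ne_zero_of_nonpos {A : ℂ} {i : ℤ} (hi : i ≤ 0)
    (h : ∀ l : ℤ, i ≤ l → l < 0 → theta p (A * q ^ l) ≠ 0) : ellFac q p A i ≠ 0 := by
  rcases i with m | m
  · obtain rfl : m = 0 := by simpa using hi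
    simp [ellFac]
  · exact inv_ne_zero (prod_ne_zero_iff.2 fun j hj => h _ (by
      have := mem_range.1 hj
      omega) (by omega))

theorem ellFac_add_natCast_div (hq : q ≠ 0) {A : ℂ} {i : ℤ} (hi : i ≤ 0)
    (h : ∀ l : ℤ, i ≤ l → l < 0 → theta p (A * q ^ l) ≠ 0) (M : ℕ) :
    ellFac q p A (i + M) / ellFac q p A i = thetaPoch q p (A * q ^ i) M := by
  rw [div_eq_iff (ellFac_ne_zero_of_nonpos hi h)]
  induction M with
  | zero => simp
  | succ M ih =>
    rw [Nat.cast_succ, ← add_assoc, ellFac_add_one _ fun h0 => h _ (by omega) h0, ih, thetaPoch,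
      thetaPoch, prod_range_succ, zpow_add₀ hq, zpow_natCast, ← mul_assoc]
    ring

/-- The prefactor of `betaPrime`. -/
def betaPrefactor (q p : ℂ) (x : Fin n → ℂ) (a b ρ₁ ρ₂ : ℂ) (N : MIdx n) : ℂ :=
  ∏ r, (ellFac q p (b * ρ₁ * x r / a) (N r) * ellFac q p (b * ρ₂ * x r / a) (N r)
      / (ellFac q p (a * x r * q / ρ₁) (N r) * ellFac q p (a * x r * q / ρ₂) (N r)))

/-- The coefficients of the sum in `betaPrime`. -/
def betaCoeff (q p : ℂ) (x : Fin n → ℂ) (a b ρ₁ ρ₂ : ℂ) (N k : MIdx n) : ℂ :=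
  ellFac q p ρ₁ (size k) * ellFac q p ρ₂ (size k)
          / (∏ r, (ellFac q p (b * ρ₁ * x r / a) (k r) * ellFac q p (b * ρ₂ * x r / a) (k r)))
        * (∏ r, (theta p (b * ρ₁ * ρ₂ * x r * q ^ (k r + size k) / (a * q))
              / theta p (b * ρ₁ * ρ₂ * x r / (a * q))
            * (ellFac q p (a * x r * q ^ (1 + (k r : ℤ) - size k) / (ρ₁ * ρ₂)) ((N r : ℤ) - k r)
              / ellFac q p (b * ρ₁ * ρ₂ * x r / a) (N r + size k))))
        * ((∏ r, ∏ s, ellFac q p (b * x r * x s) (N s + k r))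
          / ((∏ r, ∏ s ∈ Ioi r, ellFac q p (b * x r * x s) (k r + k s))
            * ∏ r, ∏ s,
              ellFac q p (q ^ (1 + (k r : ℤ) - k s) * (x r / x s)) ((N r : ℤ) - k r)))
        * (a * q / (ρ₁ * ρ₂)) ^ size k
        * (∏ r, x r ^ k r) * (q ^ pairSum k)⁻¹

/-- The factor relating `alphaPrime` to the original sequence. -/
def alphaCoeff (q p : ℂ) (x : Fin n → ℂ) (a ρ₁ ρ₂ : ℂ) (N : MIdx n) : ℂ :=
  ellFac q p ρ₁ (size N) * ellFac q p ρ₂ (size N)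
      / (∏ r, (ellFac q p (a * x r * q / ρ₁) (N r) * ellFac q p (a * x r * q / ρ₂) (N r)))
    * (a * q / (ρ₁ * ρ₂)) ^ size N
    * (∏ r, x r ^ N r) * (q ^ pairSum N)⁻¹

/-- With `β = bρ₁ρ₂/(aq)`, the parameter `c = bρ₁/a` has `βq/c = ρ₂` and vice versa. The
coefficients thus give the whole Jackson summand except the third parameter and the poles. -/
theorem betaPrefactor_mul_betaCoeff (hq : q ≠ 0) (ha : a ≠ 0) (hb : b ≠ 0) (hρ₁ : ρ₁ ≠ 0)
    (hρ₂ : ρ₂ ≠ 0)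
    (hbρ₁ : ∀ (r : Fin n) (m : ℕ), theta p (b * ρ₁ * x r * q ^ m / a) ≠ 0)
    (hbρ₂ : ∀ (r : Fin n) (m : ℕ), theta p (b * ρ₂ * x r * q ^ m / a) ≠ 0)
    {N k : MIdx n} (hk : k ≤ N) :
    betaPrefactor q p x a b ρ₁ ρ₂ N * betaCoeff q p x a b ρ₁ ρ₂ N k
      = (∏ r, (thetaPoch q p (a * x r * q / ρ₁) (N r) * thetaPoch q p (a * x r * q / ρ₂) (N r)))⁻¹
        * paramPart q p x (b * ρ₁ * ρ₂ / (a * q)) N k (b * ρ₁ / a)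
        * paramPart q p x (b * ρ₁ * ρ₂ / (a * q)) N k (b * ρ₂ / a)
        * shiftPart q p x b (b * ρ₁ * ρ₂ / (a * q)) N k := by
  have e0 : b / (b * ρ₁ * ρ₂ / (a * q)) = a * q / (ρ₁ * ρ₂) := by field_simp
  have e1 (r : Fin n) : theta p (b * ρ₁ * ρ₂ * x r * q ^ (k r + size k) / (a * q))
        / theta p (b * ρ₁ * ρ₂ * x r / (a * q))
        * (ellFac q p (a * x r * q ^ (1 + (k r : ℤ) - size k) / (ρ₁ * ρ₂)) ((N r : ℤ) - k r)
          / ellFac q p (b * ρ₁ * ρ₂ * x r / a) (N r + size k))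
      = theta p (b * ρ₁ * ρ₂ / (a * q) * x r * q ^ (k r + size k))
          / thetaPoch q p (b * ρ₁ * ρ₂ / (a * q) * x r) (N r + size k + 1)
        * thetaPoch q p (b * x r * q ^ k r / (b * ρ₁ * ρ₂ / (a * q) * q ^ size k))
          (N r - k r) := by
    rw [thetaPoch_succ', ellFac_natCast_sub (hk r), ellFac_natCast_add,
      show b * ρ₁ * ρ₂ * x r * q ^ (k r + size k) / (a * q)
        = b * ρ₁ * ρ₂ / (a * q) * x r * q ^ (k r + size k) by ring,
      show b * ρ₁ * ρ₂ * x r / (a * q) = b * ρ₁ * ρ₂ / (a * q) * x r by ring,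
      show b * ρ₁ * ρ₂ * x r / a = b * ρ₁ * ρ₂ / (a * q) * x r * q by field_simp,
      show a * x r * q ^ (1 + (k r : ℤ) - size k) / (ρ₁ * ρ₂)
        = b * x r * q ^ k r / (b * ρ₁ * ρ₂ / (a * q) * q ^ size k) by
          rw [zpow_sub₀ hq, zpow_add₀ hq, zpow_natCast, zpow_natCast, zpow_one]
          field_simp]
    rw [← div_div]
    ring
  have e2 (ρ : ℂ) (r : Fin n) :
      thetaPoch q p (b * ρ * x r / a) (N r)
        = thetaPoch q p (b * ρ * x r / a) (k r)
          * thetaPoch q p (b * ρ / a * x r * q ^ k r) (N r - k r) := by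
    rw [show b * ρ / a * x r = b * ρ * x r / a by ring, ← thetaPoch_add, Nat.add_sub_cancel' (hk r)]
  have e3 (ρ : ℂ) (h : ∀ (r : Fin n) (m : ℕ), theta p (b * ρ * x r * q ^ m / a) ≠ 0) :
      ∏ r, thetaPoch q p (b * ρ * x r / a) (k r) ≠ 0 :=
    prod_ne_zero_iff.2 fun r _ => thetaPoch_ne_zero (fun m => by
      rw [div_mul_eq_mul_div]; exact h r m) _
  have h1 := e3 ρ₁ hbρ₁
  have h2 := e3 ρ₂ hbρ₂
  have e4 : b * ρ₁ * ρ₂ / (a * q) * q / (b * ρ₁ / a) = ρ₂ := by field_simp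
  have e5 : b * ρ₁ * ρ₂ / (a * q) * q / (b * ρ₂ / a) = ρ₁ := by field_simp
  unfold betaPrefactor betaCoeff paramPart shiftPart
  simp only [e1, e4, e5, ← e0]
  simp only [ellFac_natCast, ellFac_natCast_add, ellFac_natCast_sub (hk _)]
  have aux {P₁ P₂ Q₁ Q₂ R₁ R₂ A B C D E F G H : ℂ} (hP₁ : P₁ ≠ 0) (hP₂ : P₂ ≠ 0) :
      (P₁ * Q₁) * (P₂ * Q₂) / (R₁ * R₂)
          * (A * B / (P₁ * P₂) * C * (D / E) * F * G * H)
        = (R₁ * R₂)⁻¹ * (B * Q₁) * (A * Q₂) * (C * (D / E) * (F * G * H)) := by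
    calc _ = (P₁ * P₁⁻¹) * (P₂ * P₂⁻¹)
        * ((R₁ * R₂)⁻¹ * (B * Q₁) * (A * Q₂) * (C * (D / E) * (F * G * H))) := by ring
      _ = _ := by rw [mul_inv_cancel₀ hP₁, mul_inv_cancel₀ hP₂, one_mul, one_mul]
  rw [prod_div_distrib, prod_mul_distrib, prod_congr rfl fun r _ => e2 ρ₁ r,
    prod_congr rfl fun r _ => e2 ρ₂ r, prod_mul_distrib, prod_mul_distrib, prod_mul_distrib,
    prod_mul_distrib]
  exact aux h1 h2

/-- Supplies the missing third parameter `a q^{1+|j|}` and the poles, already in the shifted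
variables. -/
theorem B1_add_left (hq : q ≠ 0) (ha : a ≠ 0) (hx : ∀ r, x r ≠ 0) (β : ℂ)
    (hax : ∀ (r : Fin n) (m : ℕ), theta p (a * x r * q ^ (m + 1)) ≠ 0)
    (j : MIdx n) {M k : MIdx n} (hk : k ≤ M) :
    B1 q p x a β (j + k) j
      = (∏ r, (thetaPoch q p (β * x r) (j r + size j)
          / thetaPoch q p (a * x r * q) ((j + M) r + size j)))
        * paramPart q p (shiftVar q x j) (β * q ^ size j) M k (a * q * q ^ size j)
        * polePart q p (shiftVar q x j) (β * q ^ size j) k := by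
  have hne (r : Fin n) (k : ℕ) : thetaPoch q p (a * x r * q) k ≠ 0 :=
    thetaPoch_ne_zero (fun m => by
      rw [mul_assoc, ← pow_succ']; exact hax r m) k
  have e1 : ellFac q p (β / a) ((size (j + k) : ℤ) - size j)
      = thetaPoch q p (β * q ^ size j * q / (a * q * q ^ size j)) (size k) := by
    rw [size_add, ellFac_natCast_sub (Nat.le_add_right _ _), Nat.add_sub_cancel_left]
    congr 1
    field_simp
  have e2 (r s : Fin n) : ellFac q p (q ^ (1 + (j r : ℤ) - j s) * (x r / x s))
        (((j + k) r : ℕ) - (j r : ℤ))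
      = thetaPoch q p (q * (shiftVar q x j r / shiftVar q x j s)) (k r) := by
    have hs := hx s
    rw [Pi.add_apply, ellFac_natCast_sub (Nat.le_add_right _ _), Nat.add_sub_cancel_left]
    congr 1
    rw [shiftVar, shiftVar, zpow_sub₀ hq, zpow_add₀ hq, zpow_natCast, zpow_natCast, zpow_one]
    field_simp
  have e3 (r : Fin n) : ellFac q p (β * x r) ((j r : ℤ) + size (j + k))
        / ellFac q p (a * x r * q) (((j + k) r : ℕ) + (size j : ℤ))
      = thetaPoch q p (β * x r) (j r + size j)
          / thetaPoch q p (a * x r * q) ((j + M) r + size j)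
        * thetaPoch q p (β * q ^ size j * shiftVar q x j r) (size k)
        * thetaPoch q p (a * q * q ^ size j * shiftVar q x j r * q ^ k r) (M r - k r) := by
    have a1 := thetaPoch_add (q := q) (p := p) (β * x r) (j r + size j) (size k)
    have a2 := thetaPoch_add (q := q) (p := p) (a * x r * q) (j r + k r + size j) (M r - k r)
    have hkr : k r ≤ M r := hk r
    rw [show j r + k r + size j + (M r - k r) = (j + M) r + size j by
      rw [Pi.add_apply]; omega] at a2
    rw [ellFac_natCast_add, ellFac_natCast_add, size_add, ← add_assoc, a1, a2, Pi.add_apply,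
      show β * q ^ size j * shiftVar q x j r = β * x r * q ^ (j r + size j) by
        rw [shiftVar, pow_add]; ring,
      show a * q * q ^ size j * shiftVar q x j r * q ^ k r
        = a * x r * q * q ^ (j r + k r + size j) by
        rw [shiftVar, pow_add, pow_add]; ring]
    have h1 := hne r ((j + M) r + size j)
    rw [a2] at h1
    have h2 := left_ne_zero_of_mul h1
    have h3 := right_ne_zero_of_mul h1
    rw [div_mul_eq_mul_div, div_mul_eq_mul_div, div_eq_div_iff h2 h1]
    ring
  unfold B1 paramPart polePart
  simp only [e1, e2, e3, prod_mul_distrib, prod_div_distrib]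
  ring

/-- Collects the factors that do not depend on `k` and multiplies them by the Jackson value. -/
theorem B4_mul_alphaCoeff (hq : q ≠ 0) (hx : ∀ r, x r ≠ 0) (ha : a ≠ 0) (hb : b ≠ 0)
    (hρ₁ : ρ₁ ≠ 0) (hρ₂ : ρ₂ ≠ 0)
    (haρ₁ : ∀ (r : Fin n) (m : ℕ), theta p (a * x r * q ^ (m + 1) / ρ₁) ≠ 0)
    (haρ₂ : ∀ (r : Fin n) (m : ℕ), theta p (a * x r * q ^ (m + 1) / ρ₂) ≠ 0)
    (hbρρ : ∀ (r : Fin n) (m : ℕ), theta p (b * ρ₁ * ρ₂ / (a * q) * x r * q ^ m) ≠ 0)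
    (hba : 2 ≤ n → ∀ (r : Fin n) (m : ℕ), theta p (b * x r / (a * q ^ (m + 1))) ≠ 0)
    (j M : MIdx n) :
    (∏ r, (thetaPoch q p (a * x r * q / ρ₁) ((j + M) r)
          * thetaPoch q p (a * x r * q / ρ₂) ((j + M) r)))⁻¹
        * thetaPoch q p ρ₂ (size j) * thetaPoch q p ρ₁ (size j)
        * shiftConst q p x b (b * ρ₁ * ρ₂ / (a * q)) j
        * (∏ r, (thetaPoch q p (b * ρ₁ * ρ₂ / (a * q) * x r) (j r + size j)
          / thetaPoch q p (a * x r * q) ((j + M) r + size j)))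
        * jacksonValue q p (shiftVar q x j) b (a * q * q ^ size j) (b * ρ₁ / a) (b * ρ₂ / a) M
      = B4 q p x a b (j + M) j * alphaCoeff q p x a ρ₁ ρ₂ j := by
  have e0 : b / (b * ρ₁ * ρ₂ / (a * q)) = a * q / (ρ₁ * ρ₂) := by field_simp
  have e1 (r : Fin n) : ellFac q p (b * x r / a) (((j + M) r : ℕ) - (size j : ℤ))
        / ellFac q p (b * x r / a) ((j r : ℤ) - size j)
      = thetaPoch q p (b * q * shiftVar q x j r / (a * q * q ^ size j)) (M r) := by
    have hle : j r ≤ size j := single_le_sum (f := j) (fun _ _ => Nat.zero_le _) (mem_univ r)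
    rw [show (((j + M) r : ℕ) : ℤ) - size j = ((j r : ℤ) - size j) + M r by
      rw [Pi.add_apply]; push_cast; ring, ellFac_add_natCast_div hq (by omega)]
    · congr 1
      rw [shiftVar, zpow_sub₀ hq, zpow_natCast, zpow_natCast]
      field_simp
    · intro l hl hl0
      -- A negative `l ≥ j_r - |j|` requires `|j| > j_r`, hence a second coordinate.
      have hn : 2 ≤ n := by
        by_contra hn
        have : Subsingleton (Fin n) := Fin.subsingleton_iff_le_one.2 (by omega)
        have : size j = j r := Fintype.sum_eq_single r fun s hs => absurd (Subsingleton.elim s r) hs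
        omega
      obtain ⟨i, rfl⟩ : ∃ i : ℕ, l = -((i + 1 : ℕ) : ℤ) := ⟨(-l - 1).toNat, by omega⟩
      convert hba hn r i using 2
      rw [zpow_neg, zpow_natCast]
      field_simp
  have e2 (r s : Fin n) : ellFac q p (b * x r * x s) (((j + M) r : ℕ) + (j s : ℤ))
      = thetaPoch q p (b * x r * x s) (j s + j r)
        * thetaPoch q p (b * shiftVar q x j r * shiftVar q x j s) (M r) := by
    rw [ellFac_natCast_add, Pi.add_apply, show j r + M r + j s = j s + j r + M r by ring,
      thetaPoch_add]
    congr 2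
    rw [shiftVar, shiftVar]; ring
  have e3 (r s : Fin n) : ellFac q p (q ^ (1 + (j r : ℤ) - j s) * (x r / x s))
        (((j + M) r : ℕ) - (j r : ℤ))
      = thetaPoch q p (q * (shiftVar q x j r / shiftVar q x j s)) (M r) := by
    have hs := hx s
    rw [Pi.add_apply, ellFac_natCast_sub (Nat.le_add_right _ _), Nat.add_sub_cancel_left]
    congr 1
    rw [shiftVar, shiftVar, zpow_sub₀ hq, zpow_add₀ hq, zpow_natCast, zpow_natCast, zpow_one]
    field_simp
  have e4 (ρ : ℂ) (hρ : ρ ≠ 0) (r : Fin n) :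
      thetaPoch q p (a * x r * q / ρ) ((j + M) r)
        = thetaPoch q p (a * x r * q / ρ) (j r)
          * thetaPoch q p (b * q * shiftVar q x j r / (b * ρ / a)) (M r) := by
    rw [Pi.add_apply, thetaPoch_add, shiftVar]
    congr 2
    field_simp
  have hne (ρ : ℂ) (h : ∀ (r : Fin n) (m : ℕ), theta p (a * x r * q ^ (m + 1) / ρ) ≠ 0) :
      ∏ r, thetaPoch q p (a * x r * q / ρ) ((j + M) r) ≠ 0 :=
    prod_ne_zero_iff.2 fun r _ => thetaPoch_ne_zero (fun m => by
      rw [show a * x r * q / ρ * q ^ m = a * x r * q ^ (m + 1) / ρ by ring]; exact h r m) _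
  have h1 := hne ρ₁ haρ₁
  have h2 := hne ρ₂ haρ₂
  have h3 : ∏ r, thetaPoch q p (b * ρ₁ * ρ₂ / (a * q) * x r) (j r + size j) ≠ 0 :=
    prod_ne_zero_iff.2 fun r _ => thetaPoch_ne_zero (hbρρ r) _
  rw [prod_congr rfl fun r _ => e4 ρ₁ hρ₁ r, prod_mul_distrib] at h1
  rw [prod_congr rfl fun r _ => e4 ρ₂ hρ₂ r, prod_mul_distrib] at h2
  have h4 := right_ne_zero_of_mul h1
  have h5 := right_ne_zero_of_mul h2
  unfold B4 alphaCoeff shiftConst jacksonValue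
  rw [e0]
  simp only [div_mul_eq_div_div (ellFac q p (b * x _ / a) _), e1, e2, e3, e4 ρ₁ hρ₁,
    e4 ρ₂ hρ₂, ellFac_natCast, ellFac_natCast_add, prod_mul_distrib, prod_div_distrib,
    prod_inv_distrib]
  have aux {A₁ Q₁ A₂ Q₂ R₁ R₂ T D E W Y Z U V B P : ℂ} (hT : T ≠ 0) (hQ₁ : Q₁ ≠ 0)
      (hQ₂ : Q₂ ≠ 0) :
      ((A₁ * Q₁) * (A₂ * Q₂))⁻¹ * R₂ * R₁ * (T⁻¹ * (D / E) * (W * Y * Z)) * (T / U)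
          * (V * Q₁ * Q₂ * (B / P))
        = D * B / (E * P) * (V / U) * (R₁ * R₂ / (A₁ * A₂) * W * Y * Z) := by
    calc _ = (T * T⁻¹) * (Q₁ * Q₁⁻¹) * (Q₂ * Q₂⁻¹)
        * (D * B / (E * P) * (V / U) * (R₁ * R₂ / (A₁ * A₂) * W * Y * Z)) := by ring
      _ = _ := by
        rw [mul_inv_cancel₀ hT, mul_inv_cancel₀ hQ₁, mul_inv_cancel₀ hQ₂, one_mul, one_mul, one_mul]
  exact aux h3 h4 h5

theorem sum_Iic_sum_Iic (N : MIdx n) (f : MIdx n → MIdx n → ℂ) :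
    ∑ k ∈ Iic N, ∑ j ∈ Iic k, f k j = ∑ j ∈ Iic N, ∑ k ∈ Iic (N - j), f (j + k) j := by
  classical
  have h1 : ∀ k ∈ Iic N, ∑ j ∈ Iic k, f k j = ∑ j ∈ Iic N, if j ≤ k then f k j else 0 := by
    intro k hk
    rw [← sum_filter]
    refine sum_congr (Finset.ext fun j => ?_) fun _ _ => rfl
    simp only [mem_Iic, mem_filter]
    exact ⟨fun h => ⟨h.trans (mem_Iic.1 hk), h⟩, fun h => h.2⟩
  rw [sum_congr rfl h1, sum_comm]
  refine sum_congr rfl fun j hj => ?_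
  have hN : j + (N - j) = N := add_tsub_cancel_of_le (mem_Iic.1 hj)
  have := sum_Iic_add j (N - j) (fun k => if j ≤ k then f k j else 0) fun k _ hjk => if_neg hjk
  rw [hN] at this
  rw [this]
  exact sum_congr rfl fun k _ => if_pos le_self_add

end BaileyLemma

end WPBailey

end

open WPBailey in
theorem mainTheorem10 (n : ℕ) (q p : ℂ) (hq : q ≠ 0) (hp : ‖p‖ < 1)
    (x : Fin n → ℂ) (hx : ∀ r, x r ≠ 0)
    (a b ρ₁ ρ₂ : ℂ) (ha : a ≠ 0) (hb : b ≠ 0) (hρ₁ : ρ₁ ≠ 0) (hρ₂ : ρ₂ ≠ 0)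
    -- none of the denominators occurring in the matrices and in the new sequences vanishes
    (hqx : ∀ (r s : Fin n) (m : ℤ), (r ≠ s ∨ m ≠ 0) → theta p (q ^ m * (x r / x s)) ≠ 0)
    (hax : ∀ (r : Fin n) (m : ℕ), theta p (a * x r * q ^ (m + 1)) ≠ 0)
    (haρ₁ : ∀ (r : Fin n) (m : ℕ), theta p (a * x r * q ^ (m + 1) / ρ₁) ≠ 0)
    (haρ₂ : ∀ (r : Fin n) (m : ℕ), theta p (a * x r * q ^ (m + 1) / ρ₂) ≠ 0)
    (hbρ₁ : ∀ (r : Fin n) (m : ℕ), theta p (b * ρ₁ * x r * q ^ m / a) ≠ 0)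
    (hbρ₂ : ∀ (r : Fin n) (m : ℕ), theta p (b * ρ₂ * x r * q ^ m / a) ≠ 0)
    (hbρρ : ∀ (r : Fin n) (m : ℕ), theta p (b * ρ₁ * ρ₂ * x r * q ^ m / (a * q)) ≠ 0)
    (hbxx : ∀ (r s : Fin n) (m : ℕ), r < s → theta p (b * x r * x s * q ^ m) ≠ 0)
    (hba : 2 ≤ n → ∀ (r : Fin n) (m : ℕ), theta p (b * x r / (a * q ^ (m + 1))) ≠ 0)
    (α β : ℂ → ℂ → MIdx n → ℂ)
    (hαβ : IsWPBaileyPair (B1 q p x) α β a (b * ρ₁ * ρ₂ / (a * q))) :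
    IsWPBaileyPair (B4 q p x) (alphaPrime q p x ρ₁ ρ₂ α) (betaPrime q p x ρ₁ ρ₂ β) a b := by
  have hβ : b * ρ₁ * ρ₂ / (a * q) ≠ 0 :=
    div_ne_zero (mul_ne_zero (mul_ne_zero hb hρ₁) hρ₂) (mul_ne_zero ha hq)
  have hβx (r : Fin n) (m : ℕ) : theta p (b * ρ₁ * ρ₂ / (a * q) * x r * q ^ m) ≠ 0 := by
    convert hbρρ r m using 2
    ring
  have hadm : Admissible q p x b (b * ρ₁ * ρ₂ / (a * q)) := ⟨hx, hb, hβ, hqx, hβx, hbxx⟩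
  have e4 : b * ρ₁ * ρ₂ / (a * q) * q / (b * ρ₁ / a) = ρ₂ := by field_simp
  have e5 : b * ρ₁ * ρ₂ / (a * q) * q / (b * ρ₂ / a) = ρ₁ := by field_simp
  intro N
  have hβN : betaPrime q p x ρ₁ ρ₂ β a b N = betaPrefactor q p x a b ρ₁ ρ₂ N
      * ∑ k ∈ Finset.Iic N, betaCoeff q p x a b ρ₁ ρ₂ N k * β a (b * ρ₁ * ρ₂ / (a * q)) k := rfl
  have hαN (j : MIdx n) : alphaPrime q p x ρ₁ ρ₂ α a b j
      = alphaCoeff q p x a ρ₁ ρ₂ j * α a (b * ρ₁ * ρ₂ / (a * q)) j := rfl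
  rw [hβN, Finset.mul_sum]
  simp only [hαN, hαβ _, Finset.mul_sum]
  rw [sum_Iic_sum_Iic]
  refine Finset.sum_congr rfl fun j hj => ?_
  obtain ⟨M, rfl⟩ := exists_add_of_le (Finset.mem_Iic.1 hj)
  -- The Jackson value is expanded back into its sum, so that the two sides can be compared term by
  -- term in `k`.
  rw [add_tsub_cancel_left, ← mul_assoc, ← B4_mul_alphaCoeff hq hx ha hb hρ₁ hρ₂ haρ₁ haρ₂ hβx hba,
    ← hasJacksonSum hp hq M _ b (b * ρ₁ * ρ₂ / (a * q) * q ^ size j) _ _ _ (hadm.shift hq j)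
      (mul_ne_zero (mul_ne_zero ha hq) (pow_ne_zero _ hq)) (div_ne_zero (mul_ne_zero hb hρ₁) ha)
      (div_ne_zero (mul_ne_zero hb hρ₂) ha) (by field_simp), Finset.mul_sum, Finset.sum_mul]
  refine Finset.sum_congr rfl fun k hk => ?_
  have hk := Finset.mem_Iic.1 hk
  have e1 := betaPrefactor_mul_betaCoeff hq ha hb hρ₁ hρ₂ hbρ₁ hbρ₂ (add_le_add_right hk j)
  rw [paramPart_shift, paramPart_shift, shiftPart_shift hq hx, e4, e5] at e1
  rw [← mul_assoc, ← mul_assoc, e1, B1_add_left hq ha hx _ hax j hk, jacksonTerm]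
  ring
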